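/- Let $\mathbb K$ be an infinite field, let $n,s,a,b$ be positive integers with $s\ge n+1$ and $b(s-n)+1\le a\le sb$, and let $R=\mathbb K[x_0,\dots,x_n]$ and $T=\mathbb K[z_1,\dots,z_s]$ with their standard gradings. Assume $a>(b-1)s+1$, put $\delta=a-(b-1)s-1$, and assume $\delta\ge s-n$. Let $f_1,\dots,f_s\in R$ be forms of a common degree $d$ that are $(s-\delta)$-generic, i.e. any at most $s-\delta+1$ of them form a regular sequence in $R$. For elements $g_1,\dots,g_s$ of a commutative ring let $$I_a(g_1^b\cdots g_s^b)=\Bigl\langle g_1^{n_1}\cdots g_s^{n_s} : 0\le n_i\le b,\ \textstyle\sum_i n_i=a\Bigr\rangle ,$$ and for an ideal $I$ of a Noetherian domain $A$ let $I^{(m)}=\bigcap_{\mathfrak p\in\operatorname{Ass}(A/I)}(I^mA_{\mathfrak p}\cap A)$ be its $m$-th symbolic power. Let $\varphi:T\to R$ be the $\mathbb K$-algebra homomorphism with $\varphi(z_i)=f_i$ for all $i$; regard $R$ as a $T$-algebra via $\varphi$, and for an ideal $I\subseteq T$ write $\varphi(I)$ for the ideal $\varphi(I)R$ of $R$. Then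 for every integer $m\ge 1$: 1. $I_a(f_1^b\cdots f_s^b)^{(m)}=\varphi\bigl(I_a(z_1^b\cdots z_s^b)^{(m)}\bigr)$. 2. If $\mathbf F_\bullet$ is a graded minimal free resolution of $T/I_a(z_1^b\cdots z_s^b)^{(m)}$ over $T$, then $\mathbf F_\bullet\otimes_T R$ is a graded minimal free resolution of $R/I_a(f_1^b\cdots f_s^b)^{(m)}$ over $R$, where a homogeneous basis element of degree $j$ of $\mathbf F_\bullet$ gives one of degree $dj$ of $\mathbf F_\bullet\otimes_T R$, and where the augmentation is the one induced by $\varphi$. 3. Let $G$ be the set of minimal monomial generators of the monomial ideal $I_a(z_1^b\cdots z_s^b)^{(m)}$, i.e. of the monomials in this ideal that are minimal with respect to divisibility. Then $\varphi$ is injective on $G$, and $\{\varphi(g): g\in G\}$ is a minimal generating set of $I_a(f_1^b\cdots f_s^b)^{(m)}$: it generates this ideal, and no proper subset of it does. -/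

import Mathlib

open MvPolynomial
open scoped TensorProduct

universe u v w

/-- The `a`-fold product ideal `I_a(f_1^{m_1} ⋯ f_s^{m_s})`, generated by all products
`f_1^{n_1} ⋯ f_s^{n_s}` with `0 ≤ n_i ≤ m_i` and `n_1 + ⋯ + n_s = a`. -/
def foldProductIdeal {A : Type*} [CommRing A] {s : ℕ} (f : Fin s → A) (m : Fin s → ℕ) (a : ℕ) :
    Ideal A :=
  Ideal.span {g | ∃ e : Fin s → ℕ, (∀ i, e i ≤ m i) ∧ ∑ i, e i = a ∧ g = ∏ i, f i ^ e i}

/-- The `m`-th symbolic power `I^(m) = ⋂_{p ∈ Ass(A/I)} (I^m A_p ∩ A)`, the intersection being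
over all (minimal and embedded) associated primes of `A/I`. -/
def symbolicPower {A : Type*} [CommRing A] (I : Ideal A) (m : ℕ) : Ideal A :=
  ⨅ p : PrimeSpectrum A, ⨅ _ : p.asIdeal ∈ associatedPrimes A (A ⧸ I),
    ((I ^ m).map (algebraMap A (Localization.AtPrime p.asIdeal))).comap
      (algebraMap A (Localization.AtPrime p.asIdeal))

/-- The family `f` is `c`-generic: any at most `c + 1` members of it form a regular sequence.
(For forms the order of the members in the sequence does not matter.) -/
def IsCGeneric {A : Type*} [CommRing A] {s : ℕ} (f : Fin s → A) (c : ℕ) : Prop :=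
  ∀ l : List (Fin s), l.Nodup → l.length ≤ c + 1 → RingTheory.Sequence.IsRegular A (l.map f)

/-- `S` is a minimal generating set of the ideal `J`. -/
def IsMinimalGeneratingSet {A : Type*} [CommRing A] (S : Set A) (J : Ideal A) : Prop :=
  Ideal.span S = J ∧ ∀ S' : Set A, S' ⊂ S → Ideal.span S' ≠ J

/-- The minimal monomial generators `G(I)` of a monomial ideal `I`: the monomials in `I` that are
minimal, with respect to divisibility, among the monomials in `I`. -/
def minimalMonomialGenerators {K : Type*} [Field K] {σ : Type*} (I : Ideal (MvPolynomial σ K)) :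
    Set (MvPolynomial σ K) :=
  {g | ∃ α : σ →₀ ℕ, g = monomial α 1 ∧ g ∈ I ∧
    ∀ β : σ →₀ ℕ, monomial β (1 : K) ∈ I → β ≤ α → β = α}

/-- `p` lies in the degree `q` part of the standard graded polynomial ring, viewed as a
`ℤ`-graded ring (so only `0` has a negative degree). -/
def PolyHasDegree {K : Type*} [Field K] {σ : Type*} (p : MvPolynomial σ K) (q : ℤ) : Prop :=
  p = 0 ∨ ∃ e : ℕ, (e : ℤ) = q ∧ p.IsHomogeneous e

/-- A sequence `⋯ → F 2 → F 1 → F 0` of finitely generated free modules over the polynomial ring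
`A = K[σ]`. Each `F i` is graded by means of a basis whose `k`-th member has degree `deg i k`;
that is, `F i = ⨁ k, A(-deg i k)` as a graded module. -/
structure GradedFreeSequence (K : Type u) [Field K] (σ : Type w) where
  F : ℕ → Type v
  [addCommGroup : ∀ i, AddCommGroup (F i)]
  [module : ∀ i, Module (MvPolynomial σ K) (F i)]
  rank : ℕ → ℕ
  basis : ∀ i, Module.Basis (Fin (rank i)) (MvPolynomial σ K) (F i)
  deg : ∀ i, Fin (rank i) → ℤ
  d : ∀ i, F (i + 1) →ₗ[MvPolynomial σ K] F i

namespace GradedFreeSequence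

attribute [instance] GradedFreeSequence.addCommGroup GradedFreeSequence.module

variable {K : Type u} [Field K] {σ : Type w}

/-- The element `x` of the graded free module `F i` is homogeneous of degree `q`. -/
def HasDegree (C : GradedFreeSequence.{u, v, w} K σ) (i : ℕ) (x : C.F i) (q : ℤ) : Prop :=
  ∀ k, PolyHasDegree ((C.basis i).repr x k) (q - C.deg i k)

/-- The sequence `C`, with augmentation `ε`, is a graded minimal free resolution of `A / I`: all
maps preserve degrees, `⋯ → F 1 → F 0 → A / I → 0` is exact, and the image of each differential
lies in `𝔪 F i`, where `𝔪` is the ideal generated by the variables. -/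
structure IsMinimalResolution (C : GradedFreeSequence.{u, v, w} K σ)
    (I : Ideal (MvPolynomial σ K))
    (ε : C.F 0 →ₗ[MvPolynomial σ K] (MvPolynomial σ K ⧸ I)) : Prop where
  d_homogeneous : ∀ (i : ℕ) (x : C.F (i + 1)) (q : ℤ),
    C.HasDegree (i + 1) x q → C.HasDegree i (C.d i x) q
  aug_homogeneous : ∀ (x : C.F 0) (q : ℤ), C.HasDegree 0 x q →
    ∃ p : MvPolynomial σ K, PolyHasDegree p q ∧ Ideal.Quotient.mk I p = ε x
  aug_surjective : Function.Surjective ε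
  exact_zero : Function.Exact (C.d 0) ε
  exact_succ : ∀ i, Function.Exact (C.d (i + 1)) (C.d i)
  minimal : ∀ i, LinearMap.range (C.d i) ≤
    MvPolynomial.idealOfVars σ K • (⊤ : Submodule (MvPolynomial σ K) (C.F i))

variable {τ : Type w}

/-- The sequence `C ⊗_T R`, where `T = K[σ]` and `R = K[τ]` is a `T`-algebra by means of a
`K`-algebra homomorphism `φ : T → R` that sends the variables to forms of degree `e`. Such a `φ`
multiplies degrees by `e`, so the member `1 ⊗ b_k` of the new basis gets the degree
`e * deg b_k`. -/
noncomputable def baseChange (C : GradedFreeSequence.{u, v, w} K σ)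
    (φ : MvPolynomial σ K →ₐ[K] MvPolynomial τ K) (e : ℕ) :
    GradedFreeSequence.{u, max u v w, w} K τ :=
  letI : Algebra (MvPolynomial σ K) (MvPolynomial τ K) := φ.toRingHom.toAlgebra
  { F := fun i => MvPolynomial τ K ⊗[MvPolynomial σ K] C.F i
    rank := C.rank
    basis := fun i => (C.basis i).baseChange (MvPolynomial τ K)
    deg := fun i k => (e : ℤ) * C.deg i k
    d := fun i => (C.d i).baseChange (MvPolynomial τ K) }

/-- The canonical map `C → C ⊗_T R`, `x ↦ 1 ⊗ x`. -/
noncomputable def toBaseChange (C : GradedFreeSequence.{u, v, w} K σ)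
    (φ : MvPolynomial σ K →ₐ[K] MvPolynomial τ K) (e : ℕ) (i : ℕ) (x : C.F i) :
    (C.baseChange φ e).F i :=
  letI : Algebra (MvPolynomial σ K) (MvPolynomial τ K) := φ.toRingHom.toAlgebra
  ((1 : MvPolynomial τ K) ⊗ₜ[MvPolynomial σ K] x :
    MvPolynomial τ K ⊗[MvPolynomial σ K] C.F i)

end GradedFreeSequence

/-! Put `k = s - δ`; then `sb - a = k - 1`, and I_a is generated by the products ∏ f_i^{w_i} whose
truncated deficits `b - w_i` sum to at most `k - 1`. The m-th symbolic power is generated by the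
products whose deficits `mb - w_i` have every k-fold sum at most `m(k - 1)`
(`symbolicPower_powerProductIdeal`). Variables are themselves generic, so the same exponents
describe both sides, which gives the first conclusion.

The engine is `isWeaklyRegular_graphSequence_deficitSet`. The ring R is R[X] modulo the graph
sequence X_i - f_i. If J is the monomial ideal of R[X] with such an exponent set, R[X]/J is filtered
with factors R[X]/(X_i : i ∈ A), |A| ≤ k. Genericity makes the graph sequence weakly regular on each
factor, hence on R[X]/J, and one may append any w in R that is a nonzerodivisor modulo every (f_i :
i ∈ A) with |A| ≤ k.

Three things follow. The appended w is a nonzerodivisor modulo the product ideal; with prime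
avoidance this computes the symbolic powers. Regularity of the graph sequence on R[X] and R[X]/J
makes T/I and R independent in the sense of Tor, so resolutions stay exact
(`exact_baseChange_of_resolution`). Finally (graph) ∩ J = (graph)J, so a relation between the
minimal products has its coefficients in (f_1, …, f_s), and none of them is redundant. -/

/-! ### Weakly regular sequences in exact sequences -/

section WeaklyRegular

open RingTheory.Sequence Function

variable {S M M₂ M₃ : Type*} [CommRing S] [AddCommGroup M] [AddCommGroup M₂] [AddCommGroup M₃]
  [Module S M] [Module S M₂] [Module S M₃]

/-- Regularity of `r` on `M₃` removes the Tor term that could obstruct injectivity. -/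
theorem injective_quotSMulTop_map {r : S} {f : M →ₗ[S] M₂} {g : M₂ →ₗ[S] M₃}
    (hf : Injective f) (hfg : Exact f g) (h : IsSMulRegular M₃ r) :
    Injective (QuotSMulTop.map r f) := by
  have h0 : Exact (0 : M →ₗ[S] M) f := (LinearMap.exact_zero_iff_injective M f).2 hf
  have h1 := QuotSMulTop.map_first_exact_on_four_term_exact_of_isSMulRegular_last h0 hfg h
  rw [map_zero] at h1
  exact (LinearMap.exact_zero_iff_injective _ _).1 h1

theorem isWeaklyRegular_middle_of_exact {rs : List S} {f : M →ₗ[S] M₂} {g : M₂ →ₗ[S] M₃}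
    (hf : Injective f) (hfg : Exact f g) (hg : Surjective g)
    (h₁ : IsWeaklyRegular M rs) (h₃ : IsWeaklyRegular M₃ rs) : IsWeaklyRegular M₂ rs := by
  induction rs generalizing M M₂ M₃ with
  | nil => exact IsWeaklyRegular.nil _ _
  | cons r rs ih =>
    rw [isWeaklyRegular_cons_iff] at h₁ h₃ ⊢
    exact ⟨isSMulRegular_of_range_eq_ker hf hfg.linearMap_ker_eq.symm h₁.1 h₃.1,
      ih (injective_quotSMulTop_map hf hfg h₃.1) (QuotSMulTop.map_exact r hfg hg)
        (QuotSMulTop.map_surjective r hg) h₁.2 h₃.2⟩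

/-- Regularity on the quotient keeps the sequence short exact after each reduction. This is how
regularity passes to the next syzygy module. -/
theorem isWeaklyRegular_left_of_exact {rs : List S} {f : M →ₗ[S] M₂} {g : M₂ →ₗ[S] M₃}
    (hf : Injective f) (hfg : Exact f g) (hg : Surjective g)
    (h₂ : IsWeaklyRegular M₂ rs) (h₃ : IsWeaklyRegular M₃ rs) : IsWeaklyRegular M rs := by
  induction rs generalizing M M₂ M₃ with
  | nil => exact IsWeaklyRegular.nil _ _
  | cons r rs ih =>
    rw [isWeaklyRegular_cons_iff] at h₂ h₃ ⊢
    exact ⟨h₂.1.of_injective f hf,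
      ih (injective_quotSMulTop_map hf hfg h₃.1) (QuotSMulTop.map_exact r hfg hg)
        (QuotSMulTop.map_surjective r hg) h₂.2 h₃.2⟩

theorem mkQ_mem_smul_top_iff (J I : Ideal S) (x : S) :
    J.mkQ x ∈ (I • ⊤ : Submodule S (S ⧸ J)) ↔ x ∈ J ⊔ I := by
  have h : (I • ⊤ : Submodule S (S ⧸ J)) = Submodule.map J.mkQ I := by
    rw [← Submodule.range_mkQ J, ← Submodule.map_top, ← Submodule.map_smul'']
    congr 1
    exact Ideal.mul_top I
  rw [h, ← Submodule.mem_comap, Submodule.comap_map_mkQ]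

theorem isWeaklyRegular_quotient_iff (J : Ideal S) (rs : List S) :
    IsWeaklyRegular (S ⧸ J) rs ↔ ∀ (i : ℕ) (h : i < rs.length) (x : S),
      rs[i] * x ∈ J ⊔ Ideal.ofList (rs.take i) → x ∈ J ⊔ Ideal.ofList (rs.take i) := by
  rw [isWeaklyRegular_iff]
  refine forall₂_congr fun i h => ?_
  rw [isSMulRegular_quotient_iff_mem_of_smul_mem, J.mkQ_surjective.forall]
  refine forall_congr' fun x => ?_
  rw [← map_smul, mkQ_mem_smul_top_iff, mkQ_mem_smul_top_iff, smul_eq_mul]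

theorem isWeaklyRegular_iff_mul_mem (rs : List S) :
    IsWeaklyRegular S rs ↔ ∀ (i : ℕ) (h : i < rs.length) (x : S),
      rs[i] * x ∈ Ideal.ofList (rs.take i) → x ∈ Ideal.ofList (rs.take i) := by
  have e : (S ⧸ (⊥ : Ideal S)) ≃ₗ[S] S := Submodule.quotEquivOfEqBot _ rfl
  rw [← e.isWeaklyRegular_congr, isWeaklyRegular_quotient_iff]
  simp only [bot_sup_eq]

/-- If `rs` is weakly regular on `S ⧸ J` then `(rs) ∩ J = (rs) J`. -/
theorem ofList_inf_le_mul_of_isWeaklyRegular {J : Ideal S} {rs : List S}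
    (h : IsWeaklyRegular (S ⧸ J) rs) : Ideal.ofList rs ⊓ J ≤ Ideal.ofList rs * J := by
  rintro x ⟨hx, hxJ⟩
  have h0 : Exact (0 : J →ₗ[S] J) J.subtype :=
    (LinearMap.exact_zero_iff_injective _ _).2 J.injective_subtype
  -- Reducing 0 → J → S → S/J modulo `rs` keeps the first map injective: J/(rs)J embeds in S/(rs).
  have h1 := map_first_exact_on_four_term_right_exact_of_isSMulRegular_last h0
    (LinearMap.exact_subtype_mkQ J) J.mkQ_surjective h
  have h2 := (h1 (Submodule.Quotient.mk ⟨x, hxJ⟩)).1 (by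
    rw [Submodule.mapQ_apply, Submodule.Quotient.mk_eq_zero]
    simpa using hx)
  obtain ⟨y, hy⟩ := h2
  obtain ⟨y, rfl⟩ := Submodule.Quotient.mk_surjective _ y
  rw [Submodule.mapQ_apply, LinearMap.zero_apply, Submodule.Quotient.mk_zero, eq_comm,
    Submodule.Quotient.mk_eq_zero] at hy
  have h3 := Submodule.mem_map_of_mem (f := J.subtype) hy
  rw [Submodule.map_smul'', Submodule.map_top, Submodule.range_subtype] at h3
  exact h3

end WeaklyRegular

/-! ### Generic families and the graph sequence -/

section Generic

open RingTheory.Sequence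

variable {R : Type*} [CommRing R] {s : ℕ}

theorem ofList_map_eq_span_image {A : Type*} [CommRing A] {ι : Type*} [DecidableEq ι] (g : ι → A)
    (l : List ι) : Ideal.ofList (l.map g) = Ideal.span (g '' (l.toFinset : Set ι)) := by
  unfold Ideal.ofList
  congr 1
  ext x
  simp

/-- Each member of the family is regular modulo any at most `k` others. -/
def IsRegularModOthers (f : Fin s → R) (k : ℕ) : Prop :=
  ∀ (A : Finset (Fin s)) (j : Fin s), j ∉ A → A.card ≤ k → ∀ x : R,
    f j * x ∈ Ideal.span (f '' A) → x ∈ Ideal.span (f '' A)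

/-- Only the last step of a regular sequence is used: list `A` first and `j` last. -/
theorem IsCGeneric.isRegularModOthers {f : Fin s → R} {k : ℕ} (h : IsCGeneric f k) :
    IsRegularModOthers f k := by
  intro A j hj hA x hx
  have h1 := (h (A.toList ++ [j]) (by
    simp [List.nodup_append, A.nodup_toList, hj]) (by simpa using hA)).toIsWeaklyRegular
  rw [isWeaklyRegular_iff_mul_mem] at h1
  have h2 := h1 A.card (by simp) x
  have e1 : List.take A.card (List.map f (A.toList ++ [j])) = A.toList.map f := by
    rw [List.map_append, List.take_append_of_le_length (by simp), List.take_of_length_le (by simp)]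
  have e2 : (List.map f (A.toList ++ [j]))[A.card]'(by simp) = f j := by
    simp [List.getElem_append_right]
  rw [e1, e2, ofList_map_eq_span_image, Finset.toList_toFinset] at h2
  exact h2 hx

/-- `X_i ↦ 0` for `i ∈ A`, `X_i ↦ f_i` for `i ∈ U \ A`, `X_i ↦ X_i` otherwise. -/
noncomputable def partialEval (f : Fin s → R) (A U : Finset (Fin s)) :
    MvPolynomial (Fin s) R →ₐ[R] MvPolynomial (Fin s) R :=
  aeval fun i => if i ∈ A then 0 else if i ∈ U then C (f i) else X i

theorem sub_aeval_mem {σ : Type*} (g : σ → MvPolynomial σ R) (J : Ideal (MvPolynomial σ R))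
    (hg : ∀ i, X i - g i ∈ J) (p : MvPolynomial σ R) : p - aeval g p ∈ J := by
  rw [← Ideal.Quotient.eq]
  have h : (Ideal.Quotient.mkₐ R J) = (Ideal.Quotient.mkₐ R J).comp (aeval g) := by
    ext i
    simpa [Ideal.Quotient.eq] using hg i
  exact DFunLike.congr_fun h p

/-- `partialEval` is a normal form. An index in both `A` and `U` imposes X_i = 0 and X_i = f_i, so
f_i = 0; these are the only relations left on coefficients. -/
theorem mem_span_X_sup_iff (f : Fin s → R) (A U : Finset (Fin s)) (p : MvPolynomial (Fin s) R) :
    p ∈ Ideal.span (X '' (A : Set (Fin s))) ⊔ Ideal.span ((fun i => X i - C (f i)) '' U) ↔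
      partialEval f A U p ∈ (Ideal.span (f '' (A ∩ U : Finset (Fin s)))).map (C : R →+* _) := by
  set J := Ideal.span (X '' (A : Set (Fin s))) ⊔
    Ideal.span ((fun i => (X i - C (f i) : MvPolynomial (Fin s) R)) '' U) with hJ
  have hX : ∀ i ∈ A, X i ∈ J := fun i hi =>
    Ideal.mem_sup_left (Ideal.subset_span ⟨i, hi, rfl⟩)
  have hU : ∀ i ∈ U, X i - C (f i) ∈ J := fun i hi =>
    Ideal.mem_sup_right (Ideal.subset_span ⟨i, hi, rfl⟩)
  have hC : (Ideal.span (f '' (A ∩ U : Finset (Fin s)))).map (C : R →+* _) ≤ J := by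
    rw [Ideal.map_span, Ideal.span_le]
    rintro _ ⟨_, ⟨i, hi, rfl⟩, rfl⟩
    have hi' := Finset.mem_inter.1 (Finset.mem_coe.1 hi)
    have := J.sub_mem (hX i hi'.1) (hU i hi'.2)
    simpa using this
  constructor
  · intro hp
    have hle : J ≤ ((Ideal.span (f '' (A ∩ U : Finset (Fin s)))).map (C : R →+* _)).comap
        (partialEval f A U) := by
      rw [hJ, sup_le_iff, Ideal.span_le, Ideal.span_le]
      constructor
      · rintro _ ⟨i, hi, rfl⟩
        have hi' : i ∈ A := hi
        simp [partialEval, hi']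
      · rintro _ ⟨i, hi, rfl⟩
        have hi' : i ∈ U := hi
        by_cases hA : i ∈ A
        · simp only [partialEval, SetLike.mem_coe, Ideal.mem_comap, map_sub, aeval_X, hA, if_true,
            zero_sub, neg_mem_iff, algHom_C, algebraMap_eq]
          exact Ideal.mem_map_of_mem _ (Ideal.subset_span ⟨i, by simp [hA, hi'], rfl⟩)
        · simp [partialEval, hA, hi']
    exact hle hp
  · intro hp
    have h1 : p - partialEval f A U p ∈ J := by
      refine sub_aeval_mem _ J (fun i => ?_) p
      by_cases hA : i ∈ A
      · simpa [hA] using hX i hA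
      · by_cases hi : i ∈ U
        · simpa [hA, hi] using hU i hi
        · simp [hA, hi]
    simpa using J.add_mem h1 (hC hp)

/-- X_t - a is monic in X_t: a coefficient of `q` outside `I`, of largest degree in X_t, would
survive modulo `I` in the product. -/
theorem mem_map_C_of_X_sub_C_mul_mem {σ : Type*} (I : Ideal R) (t : σ) (a : R)
    (q : MvPolynomial σ R) (h : (X t - C a) * q ∈ I.map (C : R →+* MvPolynomial σ R)) :
    q ∈ I.map (C : R →+* MvPolynomial σ R) := by
  rw [mem_map_C_iff] at h ⊢
  classical
  by_contra! hq
  let B := q.support.filter fun α => coeff α q ∉ I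
  have hB : B.Nonempty := by
    obtain ⟨α, hα⟩ := hq
    refine ⟨α, ?_⟩
    simp only [B, Finset.mem_filter, mem_support_iff]
    exact ⟨fun h0 => hα (h0 ▸ I.zero_mem), hα⟩
  obtain ⟨α, hα, hmax⟩ := B.exists_max_image (fun α => α t) hB
  have h1 := h (Finsupp.single t 1 + α)
  rw [sub_mul, coeff_sub, coeff_X_mul, coeff_C_mul] at h1
  have h2 : coeff (Finsupp.single t 1 + α) q ∈ I := by
    by_contra h3
    have h4 := hmax (Finsupp.single t 1 + α) (by
      simp only [B, Finset.mem_filter, mem_support_iff]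
      exact ⟨fun h0 => h3 (h0 ▸ I.zero_mem), h3⟩)
    simp at h4
  have h5 := I.add_mem h1 (I.mul_mem_left a h2)
  rw [sub_add_cancel] at h5
  exact (Finset.mem_filter.1 hα).2 h5

/-- The sequence `X_i - f_i` in `R[X_1, …, X_s]`, which generates the kernel of `X_i ↦ f_i`. -/
noncomputable def graphSequence (f : Fin s → R) : List (MvPolynomial (Fin s) R) :=
  (List.finRange s).map fun i => X i - C (f i)

/-- In normal form X_i - f_i acts as -f_i if i ∈ A, modulo at most `k` other f_j, and as a monic
linear polynomial if i ∉ A. The last element `w` acts modulo the f_i with i ∈ A. -/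
theorem isWeaklyRegular_graphSequence_span_X {f : Fin s → R} {k : ℕ}
    (hf : IsRegularModOthers f k) {w : R}
    (hw : ∀ A : Finset (Fin s), A.card ≤ k → ∀ x, w * x ∈ Ideal.span (f '' A) →
      x ∈ Ideal.span (f '' A)) (A : Finset (Fin s)) (hA : A.card ≤ k) :
    IsWeaklyRegular (MvPolynomial (Fin s) R ⧸ Ideal.span (X '' (A : Set (Fin s)) :
      Set (MvPolynomial (Fin s) R))) (graphSequence f ++ [C w]) := by
  rw [isWeaklyRegular_quotient_iff]
  intro i hi x
  have hcard : ∀ U : Finset (Fin s), (A ∩ U).card ≤ k := fun U =>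
    (Finset.card_le_card Finset.inter_subset_left).trans hA
  by_cases his : i < s
  · have e1 : (graphSequence f ++ [C w])[i] = X ⟨i, his⟩ - C (f ⟨i, his⟩) := by
      rw [List.getElem_append_left (by simpa [graphSequence] using his)]
      simp [graphSequence]
    have e2 : (graphSequence f ++ [C w]).take i =
        ((List.finRange s).take i).map fun i => X i - C (f i) := by
      rw [List.take_append_of_le_length (by simpa [graphSequence] using his.le)]
      simp [graphSequence, List.map_take]
    have hnot : (⟨i, his⟩ : Fin s) ∉ ((List.finRange s).take i).toFinset := by
      simp [List.mem_take_iff_getElem, Fin.ext_iff]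
    rw [e1, e2, ofList_map_eq_span_image, mem_span_X_sup_iff, mem_span_X_sup_iff, map_mul, map_sub]
    set U := ((List.finRange s).take i).toFinset
    have e3 : partialEval f A U (X ⟨i, his⟩) = if (⟨i, his⟩ : Fin s) ∈ A then 0 else X ⟨i, his⟩ := by
      simp [partialEval, hnot]
    have e4 : partialEval f A U (C (f ⟨i, his⟩)) = C (f ⟨i, his⟩) := by
      simp [partialEval]
    rw [e3, e4]
    split_ifs with hiA
    · intro h
      rw [zero_sub, neg_mul, neg_mem_iff, mem_map_C_iff] at h
      rw [mem_map_C_iff]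
      intro m
      have h1 := h m
      rw [coeff_C_mul] at h1
      exact hf (A ∩ U) ⟨i, his⟩ (fun h => hnot (Finset.mem_inter.1 h).2) (hcard U) _ h1
    · exact mem_map_C_of_X_sub_C_mul_mem _ _ _ _
  · have his' : i = s := by simp [graphSequence] at hi; omega
    subst his'
    have e1 : (graphSequence f ++ [C w])[i] = C w := by
      rw [List.getElem_append_right (by simp [graphSequence])]
      simp
    have e2 : (graphSequence f ++ [C w]).take i =
        (List.finRange i).map fun i => X i - C (f i) := by
      rw [List.take_append_of_le_length (by simp [graphSequence]),
        List.take_of_length_le (by simp [graphSequence])]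
      rfl
    rw [e1, e2, ofList_map_eq_span_image, mem_span_X_sup_iff, mem_span_X_sup_iff, map_mul]
    have e4 : ∀ U, partialEval f A U (C w) = C w := by
      simp [partialEval]
    rw [e4, mem_map_C_iff, mem_map_C_iff]
    intro h m
    have h1 := h m
    rw [coeff_C_mul] at h1
    exact hw _ (hcard _) _ h1

end Generic

/-! ### Filtering the complement of an upper set by cells -/

section Filtration

/-- The complement of `L` is a union of cells: the points above `gen w` that agree with `w` on `cell
w`. If the cell of `w` has least key outside `U`, then `Set.Ici (gen w)` meets the complement of `U`
in that cell only, so adjoining it leaves an upper set and the colon of `U` by `gen w` is given by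
the variables in `cell w`. Finitely many such steps reach everything. -/
theorem upperSet_filtration_induction {σ : Type*} {L : Set (σ →₀ ℕ)} (hL : IsUpperSet L)
    (cell : (σ →₀ ℕ) → Finset σ) (gen : (σ →₀ ℕ) → (σ →₀ ℕ)) (key : (σ →₀ ℕ) → ℕ)
    (hgen : ∀ w ∉ L, gen w ≤ w ∧ ∀ i ∈ cell w, gen w i = w i)
    (hcell : ∀ w ∉ L, ∀ w', gen w ≤ w' → (∀ i ∈ cell w, w' i = w i) →
      w' ∉ L ∧ gen w' = gen w ∧ cell w' = cell w ∧ key w' = key w)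
    (hkey : ∀ w w', w ≤ w' → w' ∉ L →
      key w' ≤ key w ∧ (key w = key w' → ∀ i ∈ cell w, w' i = w i))
    (hfin : (gen '' Lᶜ).Finite) {P : Set (σ →₀ ℕ) → Prop} (huniv : P Set.univ)
    (hstep : ∀ (U : Set (σ →₀ ℕ)) (w : σ →₀ ℕ), w ∉ L → IsUpperSet U →
      (∀ α, α + gen w ∈ U ↔ ∃ i ∈ cell w, α i ≠ 0) → P (U ∪ Set.Ici (gen w)) → P U) : P L := by
  -- Generalise to every upper set whose complement is a union of cells, and induct on the number of
  -- generators left.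
  suffices h : ∀ (n : ℕ) (U : Set (σ →₀ ℕ)), IsUpperSet U → L ⊆ U →
      (∀ w ∉ U, ∀ w', gen w ≤ w' → (∀ i ∈ cell w, w' i = w i) → w' ∉ U) →
      (gen '' Uᶜ).ncard = n → P U from
    h _ L hL subset_rfl (fun w hw w' h1 h2 => (hcell w hw w' h1 h2).1) rfl
  intro n
  induction n using Nat.strong_induction_on with
  | _ n ih =>
  intro U hU hLU hsat hn
  by_cases hne : Uᶜ.Nonempty
  · obtain ⟨w, hw, hmin⟩ : ∃ w ∈ Uᶜ, ∀ v ∈ Uᶜ, key w ≤ key v := by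
      let w := Function.argminOn key Uᶜ hne
      exact ⟨w, Function.argminOn_mem _ _ _, fun v hv => Function.argminOn_le _ _ hv⟩
    have hwL : w ∉ L := fun h => hw (hLU h)
    obtain ⟨hgw, hagree⟩ := hgen w hwL
    obtain ⟨hgL, hgg, hcg, hkg⟩ := hcell w hwL (gen w) le_rfl hagree
    -- Monotonicity and minimality bound the key of such a point from both sides; equality forces it
    -- into the cell of `w`.
    have key1 : ∀ v, gen w ≤ v → v ∉ U → ∀ i ∈ cell w, v i = w i := by
      intro v hv hvU i hi
      have h1 := hkey (gen w) v hv (fun h => hvU (hLU h))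
      have h2 := hmin v hvU
      rw [hkg, hcg] at h1
      rw [h1.2 (le_antisymm h2 h1.1) i hi, hagree i hi]
    have hU' : IsUpperSet (U ∪ Set.Ici (gen w)) := hU.union (isUpperSet_Ici _)
    refine hstep U w hwL hU (fun α => ⟨fun h => ?_, ?_⟩) (ih _ ?_ _ hU' ?_ ?_ rfl)
    · by_contra! h0
      refine hsat w hw (α + gen w) le_add_self (fun i hi => ?_) h
      rw [Finsupp.add_apply, h0 i hi, zero_add, hagree i hi]
    · rintro ⟨i, hi, h0⟩
      by_contra h
      have := key1 _ le_add_self h i hi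
      rw [Finsupp.add_apply, hagree i hi] at this
      omega
    · rw [← hn]
      apply Set.ncard_lt_ncard
      · refine ⟨Set.image_mono (Set.compl_subset_compl.2 Set.subset_union_left), fun hsub => ?_⟩
        obtain ⟨v, hv, hvg⟩ := hsub ⟨w, hw, rfl⟩
        have hvL : v ∉ L := fun h => hv (Or.inl (hLU h))
        exact hv (Or.inr (hvg ▸ (hgen v hvL).1))
      · exact hfin.subset (Set.image_mono (Set.compl_subset_compl.2 hLU))
    · exact hLU.trans Set.subset_union_left
    · intro v hv v' h1 h2 h3
      have hvU : v ∉ U := fun h => hv (Or.inl h)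
      have hv'U := hsat v hvU v' h1 h2
      have h4 : gen w ≤ v' := h3.resolve_left hv'U
      have h5 := (hcell w hwL v' h4 (key1 v' h4 hv'U)).2.1
      have h6 := (hcell v (fun h => hvU (hLU h)) v' h1 h2).2.1
      have h7 := (hgen v (fun h => hvU (hLU h))).1
      rw [← h6, h5] at h7
      exact hv (Or.inr h7)
  · rw [Set.not_nonempty_iff_eq_empty, Set.compl_empty_iff] at hne
    rwa [hne]

end Filtration

/-! ### Deficits and the cells of a deficit set -/

section TopSet

variable {s : ℕ}

theorem exists_card_eq_forall_sum_le {k : ℕ} (hk : k ≤ s) (v : Fin s → ℕ) :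
    ∃ A : Finset (Fin s), A.card = k ∧
      ∀ A' : Finset (Fin s), A'.card = k → ∑ i ∈ A', v i ≤ ∑ i ∈ A, v i := by
  obtain ⟨A, hA, hmax⟩ := (Finset.powersetCard k (Finset.univ : Finset (Fin s))).exists_max_image
    (fun A => ∑ i ∈ A, v i) (by rw [Finset.powersetCard_nonempty]; simpa using hk)
  refine ⟨A, (Finset.mem_powersetCard.1 hA).2, fun A' hA' => hmax A' ?_⟩
  exact Finset.mem_powersetCard.2 ⟨Finset.subset_univ _, hA'⟩

/-- Exchanging `i` for `j` cannot increase the sum, and injectivity excludes ties. -/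
theorem lt_of_mem_of_notMem_of_forall_sum_le {v : Fin s → ℕ} (hv : Function.Injective v)
    {A : Finset (Fin s)}
    (hA : ∀ A' : Finset (Fin s), A'.card = A.card → ∑ i ∈ A', v i ≤ ∑ i ∈ A, v i)
    {i j : Fin s} (hi : i ∈ A) (hj : j ∉ A) : v j < v i := by
  have hj' : j ∉ A.erase i := fun h => hj (Finset.mem_of_mem_erase h)
  have h1 := hA (insert j (A.erase i)) (by
    rw [Finset.card_insert_of_notMem hj', Finset.card_erase_add_one hi])
  rw [Finset.sum_insert hj', ← Finset.add_sum_erase A v hi] at h1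
  have h2 : v j ≠ v i := fun h => hj (hv h ▸ hi)
  omega

theorem eq_of_forall_lt {v : Fin s → ℕ} {A A' : Finset (Fin s)} (hc : A.card = A'.card)
    (hA : ∀ i ∈ A, ∀ j ∉ A, v j < v i) (hA' : ∀ i ∈ A', ∀ j ∉ A', v j < v i) : A = A' := by
  by_contra hne
  obtain ⟨i, hi, hi'⟩ := Finset.not_subset.1 fun h => hne (Finset.eq_of_subset_of_card_le h hc.ge)
  obtain ⟨j, hj, hj'⟩ := Finset.not_subset.1 fun h =>
    hne (Finset.eq_of_subset_of_card_le h hc.le).symm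
  exact lt_asymm (hA i hi j hj') (hA' j hj i hi')

/-- Exponents of the monomials whose deficits `B - w_i` have every `k`-fold sum at most `c`. -/
def deficitSet (s B k c : ℕ) : Set (Fin s →₀ ℕ) :=
  {w | ∀ A : Finset (Fin s), A.card = k → ∑ i ∈ A, (B - w i) ≤ c}

theorem isUpperSet_deficitSet (B k c : ℕ) : IsUpperSet (deficitSet s B k c) := fun _ _ hw h A hA =>
  (Finset.sum_le_sum fun i _ => Nat.sub_le_sub_left (hw i) B).trans (h A hA)

/-- The deficits of `w`, perturbed so as to be pairwise different. -/
def deficitWeight (B : ℕ) (w : Fin s →₀ ℕ) (i : Fin s) : ℕ := (s * s + 1) * (B - w i) + i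

theorem deficitWeight_injective (B : ℕ) (w : Fin s →₀ ℕ) :
    Function.Injective (deficitWeight B w) := by
  intro i j h
  have hi : (i : ℕ) < s * s + 1 := by nlinarith [i.2]
  have hj : (j : ℕ) < s * s + 1 := by nlinarith [j.2]
  have h1 := congrArg (· % (s * s + 1)) h
  simp only [deficitWeight, Nat.mul_add_mod, Nat.mod_eq_of_lt hi, Nat.mod_eq_of_lt hj] at h1
  exact Fin.ext h1

theorem sum_deficitWeight (B : ℕ) (w : Fin s →₀ ℕ) (A : Finset (Fin s)) :
    ∑ i ∈ A, deficitWeight B w i = (s * s + 1) * ∑ i ∈ A, (B - w i) + ∑ i ∈ A, (i : ℕ) := by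
  simp only [deficitWeight, Finset.sum_add_distrib, Finset.mul_sum]

/-- The tie-breaking terms sum to at most s², less than the scale s² + 1, so they never reverse a
strict comparison. -/
theorem sum_deficit_le_of_sum_deficitWeight_le {B : ℕ} {w : Fin s →₀ ℕ} {A A' : Finset (Fin s)}
    (h : ∑ i ∈ A', deficitWeight B w i ≤ ∑ i ∈ A, deficitWeight B w i) :
    ∑ i ∈ A', (B - w i) ≤ ∑ i ∈ A, (B - w i) := by
  rw [sum_deficitWeight, sum_deficitWeight] at h
  have h1 : ∑ i ∈ A, (i : ℕ) ≤ s * s := by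
    refine (Finset.sum_le_card_nsmul A _ s fun i _ => i.2.le).trans ?_
    rw [smul_eq_mul]
    exact Nat.mul_le_mul_right _ (by simpa using Finset.card_le_univ A)
  by_contra! h2
  have h3 := Nat.mul_le_mul_left (s * s + 1) (Nat.succ_le_of_lt h2)
  rw [Nat.mul_succ] at h3
  omega

/-- The set of the `k` indices with the largest perturbed deficits. -/
noncomputable def topSet {k : ℕ} (hk : k ≤ s) (B : ℕ) (w : Fin s →₀ ℕ) : Finset (Fin s) :=
  (exists_card_eq_forall_sum_le hk (deficitWeight B w)).choose

variable {k : ℕ} (hk : k ≤ s) {B c : ℕ} (w : Fin s →₀ ℕ)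

theorem card_topSet : (topSet hk B w).card = k :=
  (exists_card_eq_forall_sum_le hk (deficitWeight B w)).choose_spec.1

theorem sum_le_sum_topSet {A : Finset (Fin s)} (hA : A.card = k) :
    ∑ i ∈ A, deficitWeight B w i ≤ ∑ i ∈ topSet hk B w, deficitWeight B w i :=
  (exists_card_eq_forall_sum_le hk (deficitWeight B w)).choose_spec.2 A hA

theorem deficitWeight_lt_of_mem_topSet {i j : Fin s} (hi : i ∈ topSet hk B w)
    (hj : j ∉ topSet hk B w) : deficitWeight B w j < deficitWeight B w i :=
  lt_of_mem_of_notMem_of_forall_sum_le (deficitWeight_injective B w)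
    (fun _ hA => sum_le_sum_topSet hk w (hA.trans (card_topSet hk w))) hi hj

variable {w}

theorem topSet_eq_of_forall_lt {A : Finset (Fin s)} (hA : A.card = k)
    (h : ∀ i ∈ A, ∀ j ∉ A, deficitWeight B w j < deficitWeight B w i) : topSet hk B w = A :=
  eq_of_forall_lt ((card_topSet hk w).trans hA.symm)
    (fun _ hi _ hj => deficitWeight_lt_of_mem_topSet hk w hi hj) h

theorem topSet_eq_of_sum_le {A : Finset (Fin s)} (hA : A.card = k)
    (h : ∑ i ∈ topSet hk B w, deficitWeight B w i ≤ ∑ i ∈ A, deficitWeight B w i) :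
    topSet hk B w = A :=
  topSet_eq_of_forall_lt hk hA fun _ hi _ hj =>
    lt_of_mem_of_notMem_of_forall_sum_le (deficitWeight_injective B w)
      (fun _ hA' => (sum_le_sum_topSet hk w (hA'.trans hA)).trans h) hi hj

/-- The top set also maximises the unperturbed sum, so it alone decides membership. -/
theorem notMem_deficitSet_iff :
    w ∉ deficitSet s B k c ↔ c < ∑ i ∈ topSet hk B w, (B - w i) := by
  constructor
  · intro h
    simp only [deficitSet, Set.mem_ofPred_eq, not_forall, not_le] at h
    obtain ⟨A, hA, h⟩ := h
    exact h.trans_le (sum_deficit_le_of_sum_deficitWeight_le (sum_le_sum_topSet hk w hA))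
  · intro h h'
    exact (h' _ (card_topSet hk w)).not_gt h

variable (B w) in
/-- The coordinates which are constant on the cell of `w`. -/
noncomputable def deficitCell : Finset (Fin s) := (topSet hk B w).filter fun i => w i < B

theorem card_deficitCell_le : (deficitCell hk B w).card ≤ k :=
  (Finset.card_filter_le _ _).trans (card_topSet hk w).le

variable (B w) in
/-- The least element of the cell of `w`. -/
noncomputable def deficitGen : Fin s →₀ ℕ := Finsupp.equivFunOnFinite.symm fun j =>
  if j ∈ topSet hk B w then B - (B - w j)
  else sInf {x | ∀ i ∈ topSet hk B w, (s * s + 1) * (B - x) + j < deficitWeight B w i}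

theorem deficitGen_of_mem {i : Fin s} (hi : i ∈ topSet hk B w) :
    deficitGen hk B w i = B - (B - w i) := by
  simp [deficitGen, hi]

theorem deficitGen_of_notMem {j : Fin s} (hj : j ∉ topSet hk B w) :
    deficitGen hk B w j =
      sInf {x | ∀ i ∈ topSet hk B w, (s * s + 1) * (B - x) + j < deficitWeight B w i} := by
  simp [deficitGen, hj]

theorem deficitGen_le : deficitGen hk B w ≤ w := by
  intro j
  by_cases hj : j ∈ topSet hk B w
  · rw [deficitGen_of_mem hk hj]
    omega
  · rw [deficitGen_of_notMem hk hj]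
    exact Nat.sInf_le fun i hi => deficitWeight_lt_of_mem_topSet hk w hi hj

theorem deficitGen_eq_of_mem_deficitCell {i : Fin s} (hi : i ∈ deficitCell hk B w) :
    deficitGen hk B w i = w i := by
  obtain ⟨h1, h2⟩ := Finset.mem_filter.1 hi
  rw [deficitGen_of_mem hk h1]
  omega

theorem deficitGen_le_const (j : Fin s) : deficitGen hk B w j ≤ B := by
  by_cases hj : j ∈ topSet hk B w
  · rw [deficitGen_of_mem hk hj]
    omega
  · rcases le_total (w j) B with h | h
    · exact (deficitGen_le hk j).trans h
    · rw [deficitGen_of_notMem hk hj]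
      refine Nat.sInf_le fun i hi => ?_
      have := deficitWeight_lt_of_mem_topSet hk w hi hj
      rwa [deficitWeight, Nat.sub_eq_zero_of_le h, ← Nat.sub_self B] at this

variable (B) in
theorem finite_range_deficitGen : (Set.range (deficitGen hk B)).Finite := by
  refine Set.Finite.subset (Set.finite_Iic (Finsupp.equivFunOnFinite.symm fun _ : Fin s => B)) ?_
  rintro _ ⟨w, rfl⟩ j
  simpa using deficitGen_le_const hk j

/-- A coordinate of the top set that the cell leaves free has `w i ≥ B`; the generator equals `B`
there, so both deficits vanish. -/
theorem deficit_eq_of_cell {w' : Fin s →₀ ℕ} (h1 : deficitGen hk B w ≤ w')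
    (h2 : ∀ i ∈ deficitCell hk B w, w' i = w i)
    {i : Fin s} (hi : i ∈ topSet hk B w) : B - w' i = B - w i := by
  by_cases hiB : w i < B
  · rw [h2 i (Finset.mem_filter.2 ⟨hi, hiB⟩)]
  · have := h1 i
    rw [deficitGen_of_mem hk hi] at this
    omega

/-- Deficits on the top set do not change, and the generator was chosen to keep all other perturbed
deficits below them. -/
theorem topSet_eq_of_cell {w' : Fin s →₀ ℕ} (h1 : deficitGen hk B w ≤ w')
    (h2 : ∀ i ∈ deficitCell hk B w, w' i = w i) : topSet hk B w' = topSet hk B w := by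
  refine topSet_eq_of_forall_lt hk (card_topSet hk w) fun i hi j hj => ?_
  have h4 : deficitGen hk B w j ∈
      {x | ∀ i ∈ topSet hk B w, (s * s + 1) * (B - x) + j < deficitWeight B w i} := by
    rw [deficitGen_of_notMem hk hj]
    exact Nat.sInf_mem ⟨w j, fun i hi => deficitWeight_lt_of_mem_topSet hk w hi hj⟩
  have h5 := h4 i hi
  have h6 := Nat.mul_le_mul_left (s * s + 1) (Nat.sub_le_sub_left (h1 j) B)
  rw [deficitWeight] at h5 ⊢
  rw [deficitWeight, deficit_eq_of_cell hk h1 h2 hi]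
  omega

theorem deficitWeight_eq_of_cell {w' : Fin s →₀ ℕ} (h1 : deficitGen hk B w ≤ w')
    (h2 : ∀ i ∈ deficitCell hk B w, w' i = w i)
    {i : Fin s} (hi : i ∈ topSet hk B w) :
    deficitWeight B w' i = deficitWeight B w i := by
  rw [deficitWeight, deficitWeight, deficit_eq_of_cell hk h1 h2 hi]

theorem deficitGen_eq_of_cell {w' : Fin s →₀ ℕ} (h1 : deficitGen hk B w ≤ w')
    (h2 : ∀ i ∈ deficitCell hk B w, w' i = w i) : deficitGen hk B w' = deficitGen hk B w := by
  ext j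
  by_cases hj : j ∈ topSet hk B w
  · rw [deficitGen_of_mem hk hj, deficitGen_of_mem hk (by rwa [topSet_eq_of_cell hk h1 h2]),
      deficit_eq_of_cell hk h1 h2 hj]
  · rw [deficitGen_of_notMem hk hj, deficitGen_of_notMem hk (by rwa [topSet_eq_of_cell hk h1 h2]),
      topSet_eq_of_cell hk h1 h2]
    congr 1
    ext x
    refine forall₂_congr fun i hi => ?_
    rw [deficitWeight_eq_of_cell hk h1 h2 hi]

theorem deficitCell_eq_of_cell {w' : Fin s →₀ ℕ} (h1 : deficitGen hk B w ≤ w')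
    (h2 : ∀ i ∈ deficitCell hk B w, w' i = w i) : deficitCell hk B w' = deficitCell hk B w := by
  rw [deficitCell, deficitCell, topSet_eq_of_cell hk h1 h2]
  refine Finset.filter_congr fun i hi => ?_
  have := deficit_eq_of_cell hk h1 h2 hi
  omega

/-- The key is the perturbed deficit sum of the top set. Raising exponents cannot increase it; if it
stays the same, so do the top set and its deficits. A cell fixes at most `k` coordinates, whence the
bound on `A`. -/
theorem deficitSet_filtration_induction {k : ℕ} (hk : k ≤ s) {B c : ℕ}
    {P : Set (Fin s →₀ ℕ) → Prop} (huniv : P Set.univ)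
    (hstep : ∀ (U : Set (Fin s →₀ ℕ)) (g : Fin s →₀ ℕ) (A : Finset (Fin s)), A.card ≤ k →
      IsUpperSet U → (∀ α, α + g ∈ U ↔ ∃ i ∈ A, α i ≠ 0) → P (U ∪ Set.Ici g) → P U) :
    P (deficitSet s B k c) := by
  refine upperSet_filtration_induction (isUpperSet_deficitSet B k c) (deficitCell hk B)
    (deficitGen hk B) (fun w => ∑ i ∈ topSet hk B w, deficitWeight B w i)
    (fun w _ => ⟨deficitGen_le hk, fun i => deficitGen_eq_of_mem_deficitCell hk⟩) ?_ ?_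
    ((finite_range_deficitGen hk B).subset (Set.image_subset_range _ _)) huniv
    (fun U w _ hU hα => hstep U _ _ (card_deficitCell_le hk) hU hα)
  · intro w hw w' h1 h2
    refine ⟨?_, deficitGen_eq_of_cell hk h1 h2, deficitCell_eq_of_cell hk h1 h2, ?_⟩
    · rw [notMem_deficitSet_iff hk] at hw ⊢
      rw [topSet_eq_of_cell hk h1 h2]
      exact hw.trans_eq (Finset.sum_congr rfl fun i hi => (deficit_eq_of_cell hk h1 h2 hi).symm)
    · simp only [topSet_eq_of_cell hk h1 h2]
      exact Finset.sum_congr rfl fun i hi => deficitWeight_eq_of_cell hk h1 h2 hi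
  · intro w w' hle _
    have hpt : ∀ i, deficitWeight B w' i ≤ deficitWeight B w i := fun i =>
      Nat.add_le_add_right (Nat.mul_le_mul_left _ (Nat.sub_le_sub_left (hle i) B)) _
    have hs1 : ∑ i ∈ topSet hk B w', deficitWeight B w' i ≤
        ∑ i ∈ topSet hk B w', deficitWeight B w i := Finset.sum_le_sum fun i _ => hpt i
    have hs2 := sum_le_sum_topSet (B := B) hk w (card_topSet (B := B) hk w')
    refine ⟨hs1.trans hs2, fun heq i hi => ?_⟩
    have htop : topSet hk B w = topSet hk B w' :=
      topSet_eq_of_sum_le hk (card_topSet hk w') (heq.trans_le hs1)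
    obtain ⟨hi1, hi2⟩ := Finset.mem_filter.1 hi
    have h3 : ∑ i ∈ topSet hk B w', deficitWeight B w' i =
        ∑ i ∈ topSet hk B w', deficitWeight B w i := le_antisymm hs1 (hs2.trans heq.le)
    have h4 := (Finset.sum_eq_sum_iff_of_le fun i _ => hpt i).1 h3 i (htop ▸ hi1)
    have h5 : B - w' i = B - w i := by
      simpa [deficitWeight] using h4
    -- As `w i < B`, the deficit is positive, so truncation loses nothing.
    omega

end TopSet

/-! ### Monomial ideals and regularity of the graph sequence -/

section ExponentIdeal

open RingTheory.Sequence Function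

/-- The sequence 0 → S/P → S/J → S/J' → 0, with first map multiplication by `e`, is exact. -/
theorem isWeaklyRegular_quotient_of_colon {S : Type*} [CommRing S] {J J' P : Ideal S} {e : S}
    {rs : List S} (hJ' : J' = J ⊔ Ideal.span {e}) (hP : ∀ x, e * x ∈ J ↔ x ∈ P)
    (h : IsWeaklyRegular (S ⧸ P) rs) (h' : IsWeaklyRegular (S ⧸ J') rs) :
    IsWeaklyRegular (S ⧸ J) rs := by
  have hle : J ≤ J' := hJ' ▸ le_sup_left
  have hPJ : P ≤ Submodule.comap (LinearMap.mulLeft S e) J := fun x hx => (hP x).2 hx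
  refine isWeaklyRegular_middle_of_exact
    (f := Submodule.mapQ P J (LinearMap.mulLeft S e) hPJ)
    (g := Submodule.factor hle) ?_ ?_ (Submodule.factor_surjective hle) h h'
  · rw [← LinearMap.ker_eq_bot, LinearMap.ker_eq_bot']
    intro x
    obtain ⟨x, rfl⟩ := Submodule.Quotient.mk_surjective _ x
    rw [Submodule.mapQ_apply, Submodule.Quotient.mk_eq_zero, Submodule.Quotient.mk_eq_zero]
    exact (hP x).1
  · intro y
    obtain ⟨y, rfl⟩ := Submodule.Quotient.mk_surjective _ y
    rw [show Submodule.factor hle (Submodule.Quotient.mk y) = Submodule.Quotient.mk y from rfl,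
      Submodule.Quotient.mk_eq_zero, hJ', Set.mem_range]
    constructor
    · intro hy
      obtain ⟨j, hj, z, hz, rfl⟩ := Submodule.mem_sup.1 hy
      obtain ⟨a, rfl⟩ := Ideal.mem_span_singleton'.1 hz
      refine ⟨Submodule.Quotient.mk a, ?_⟩
      rw [Submodule.mapQ_apply, Submodule.Quotient.eq]
      simpa [mul_comm] using hj
    · rintro ⟨x, hx⟩
      obtain ⟨x, rfl⟩ := Submodule.Quotient.mk_surjective _ x
      rw [Submodule.mapQ_apply, Submodule.Quotient.eq] at hx
      have h1 : e * x ∈ J ⊔ Ideal.span {e} :=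
        Ideal.mem_sup_right (Ideal.mul_mem_right _ _ (Ideal.mem_span_singleton_self e))
      have h2 := Ideal.sub_mem _ h1 (Ideal.mem_sup_left hx)
      simpa using h2

variable {σ R : Type*} [CommRing R]

variable (R) in
/-- The ideal generated by the monomials with exponents in `U`. -/
noncomputable def exponentIdeal (U : Set (σ →₀ ℕ)) : Ideal (MvPolynomial σ R) :=
  Ideal.span ((fun α => monomial α (1 : R)) '' U)

theorem mem_exponentIdeal_iff {U : Set (σ →₀ ℕ)} (hU : IsUpperSet U) {p : MvPolynomial σ R} :
    p ∈ exponentIdeal R U ↔ ∀ α, coeff α p ≠ 0 → α ∈ U := by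
  rw [exponentIdeal, mem_ideal_span_monomial_image]
  simp only [mem_support_iff]
  exact forall₂_congr fun α _ => ⟨fun ⟨β, hβ, h⟩ => hU h hβ, fun h => ⟨α, h, le_rfl⟩⟩

theorem exponentIdeal_union (U V : Set (σ →₀ ℕ)) :
    exponentIdeal R (U ∪ V) = exponentIdeal R U ⊔ exponentIdeal R V := by
  rw [exponentIdeal, Set.image_union, Ideal.span_union]
  rfl

theorem exponentIdeal_Ici (g : σ →₀ ℕ) :
    exponentIdeal R (Set.Ici g) = Ideal.span {monomial g (1 : R)} := by
  apply le_antisymm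
  · rw [exponentIdeal, Ideal.span_le]
    rintro _ ⟨α, hα, rfl⟩
    obtain ⟨β, rfl⟩ := exists_add_of_le (Set.mem_Ici.1 hα)
    exact Ideal.mem_span_singleton'.2 ⟨monomial β 1, by rw [monomial_mul, add_comm, one_mul]⟩
  · rw [Ideal.span_singleton_le_iff_mem]
    exact Ideal.subset_span ⟨g, Set.mem_Ici.2 le_rfl, rfl⟩

theorem monomial_mul_mem_exponentIdeal_iff {U : Set (σ →₀ ℕ)} (hU : IsUpperSet U)
    {g : σ →₀ ℕ} {A : Finset σ} (hA : ∀ α, α + g ∈ U ↔ ∃ i ∈ A, α i ≠ 0) (p : MvPolynomial σ R) :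
    monomial g 1 * p ∈ exponentIdeal R U ↔ p ∈ Ideal.span (X '' (A : Set σ)) := by
  rw [mem_exponentIdeal_iff hU, mem_ideal_span_X_image]
  simp only [mem_support_iff]
  constructor
  · intro h α hα
    refine (hA α).1 (h _ ?_)
    rwa [add_comm, coeff_monomial_mul, one_mul]
  · intro h α hα
    rw [coeff_monomial_mul'] at hα
    split_ifs at hα with hle
    · rw [one_mul] at hα
      have := (hA _).2 (h _ hα)
      rwa [tsub_add_cancel_of_le hle] at this
    · exact absurd rfl hα

variable {s k : ℕ} {f : Fin s → R}

/-- Cell induction starts at the zero module; each step adds a factor R[X]/(X_i : i ∈ A) with |A| ≤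
k, where regularity is known. -/
theorem isWeaklyRegular_graphSequence_deficitSet (hk : k ≤ s) (hf : IsRegularModOthers f k) {w : R}
    (hw : ∀ A : Finset (Fin s), A.card ≤ k → ∀ x, w * x ∈ Ideal.span (f '' A) →
      x ∈ Ideal.span (f '' A)) (B c : ℕ) :
    IsWeaklyRegular (MvPolynomial (Fin s) R ⧸ exponentIdeal R (deficitSet s B k c))
      (graphSequence f ++ [C w]) := by
  refine deficitSet_filtration_induction hk
    (P := fun U => IsWeaklyRegular (MvPolynomial (Fin s) R ⧸ exponentIdeal R U)
      (graphSequence f ++ [C w])) ?_ ?_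
  · have h : exponentIdeal R (Set.univ : Set (Fin s →₀ ℕ)) = ⊤ :=
      Ideal.eq_top_of_isUnit_mem _ (Ideal.subset_span ⟨0, trivial, rfl⟩) (by simp)
    rw [h, isWeaklyRegular_quotient_iff]
    simp
  · intro U g A hA hU hα h
    refine isWeaklyRegular_quotient_of_colon ?_ (monomial_mul_mem_exponentIdeal_iff hU hα)
      (isWeaklyRegular_graphSequence_span_X hf hw A hA) h
    rw [exponentIdeal_union, exponentIdeal_Ici]

/-- The ideal generated by the products `∏ f_i ^ α_i` with `α ∈ U`. -/
def powerProductIdeal (f : Fin s → R) (U : Set (Fin s →₀ ℕ)) : Ideal R :=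
  Ideal.span ((fun α => ∏ i, f i ^ α i) '' U)

theorem aeval_monomial_one {K : Type*} [CommRing K] [Algebra K R] (f : Fin s → R)
    (α : Fin s →₀ ℕ) : aeval f (monomial α (1 : K)) = ∏ i, f i ^ α i := by
  rw [aeval_monomial, map_one, one_mul, Finsupp.prod_fintype _ _ fun i => pow_zero _]

theorem map_aeval_exponentIdeal {K : Type*} [CommRing K] [Algebra K R] (f : Fin s → R)
    (U : Set (Fin s →₀ ℕ)) :
    (exponentIdeal K U).map (aeval f : MvPolynomial (Fin s) K →ₐ[K] R) =
      powerProductIdeal f U := by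
  rw [exponentIdeal, Ideal.map_span, powerProductIdeal, Set.image_image]
  simp only [aeval_monomial_one]

theorem powerProductIdeal_X (K : Type*) [CommRing K] (U : Set (Fin s →₀ ℕ)) :
    powerProductIdeal (fun i => (X i : MvPolynomial (Fin s) K)) U = exponentIdeal K U := by
  rw [← map_aeval_exponentIdeal (K := K), aeval_X_left]
  exact Ideal.map_id _

theorem powerProductIdeal_mono {U V : Set (Fin s →₀ ℕ)} (h : U ⊆ V) :
    powerProductIdeal f U ≤ powerProductIdeal f V :=
  Ideal.span_mono (Set.image_mono h)

theorem sub_C_aeval_mem_ofList (f : Fin s → R) (p : MvPolynomial (Fin s) R) :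
    p - C (aeval f p) ∈ Ideal.ofList (graphSequence f) := by
  have h := sub_aeval_mem (fun i => C (f i)) (Ideal.ofList (graphSequence f))
    (fun i => Ideal.subset_span (by simp [graphSequence])) p
  have h2 : aeval (fun i => (C (f i) : MvPolynomial (Fin s) R)) p = C (aeval f p) := by
    have : (aeval fun i => C (f i) : MvPolynomial (Fin s) R →ₐ[R] MvPolynomial (Fin s) R) =
        (Algebra.ofId R _).comp (aeval f) := by
      ext i
      simp [Algebra.ofId_apply]
    rw [this]
    rfl
  rwa [h2] at h

theorem mem_ofList_graphSequence_iff (f : Fin s → R) (p : MvPolynomial (Fin s) R) :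
    p ∈ Ideal.ofList (graphSequence f) ↔ aeval f p = 0 := by
  constructor
  · intro hp
    have hle : Ideal.ofList (graphSequence f) ≤
        RingHom.ker (aeval f : MvPolynomial (Fin s) R →ₐ[R] R) := by
      refine Ideal.span_le.2 fun x hx => ?_
      simp only [graphSequence, List.mem_map, Set.mem_ofPred_eq] at hx
      obtain ⟨i, -, rfl⟩ := hx
      simp
    exact hle hp
  · intro hp
    simpa [hp] using sub_C_aeval_mem_ofList f p

/-- Evaluation at `f` identifies R[X] modulo the graph sequence with R, and carries the monomial
ideal to the product ideal. -/
theorem C_mem_sup_ofList_iff (f : Fin s → R) (U : Set (Fin s →₀ ℕ)) (x : R) :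
    C x ∈ exponentIdeal R U ⊔ Ideal.ofList (graphSequence f) ↔ x ∈ powerProductIdeal f U := by
  rw [← map_aeval_exponentIdeal (K := R)]
  constructor
  · intro h
    obtain ⟨y, hy, z, hz, hyz⟩ := Submodule.mem_sup.1 h
    have h1 := congrArg (aeval f) hyz
    rw [map_add, (mem_ofList_graphSequence_iff f z).1 hz, add_zero, aeval_C] at h1
    rw [← show aeval f y = x from h1]
    exact Ideal.mem_map_of_mem _ hy
  · intro h
    obtain ⟨y, hy, rfl⟩ := (Ideal.mem_map_iff_of_surjective _
      (fun r => ⟨C r, by simp⟩ : Function.Surjective (aeval f : MvPolynomial (Fin s) R →ₐ[R] R))).1 h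
    have h1 := Ideal.sub_mem _ (Ideal.mem_sup_left hy)
      (Ideal.mem_sup_right (sub_C_aeval_mem_ofList f y))
    simpa using h1

/-- This is the last step of the extended sequence: once the graph sequence is divided out, `w` acts
on R modulo the product ideal. -/
theorem mem_powerProductIdeal_of_mul_mem (hk : k ≤ s) (hf : IsRegularModOthers f k) {w : R}
    (hw : ∀ A : Finset (Fin s), A.card ≤ k → ∀ x, w * x ∈ Ideal.span (f '' A) →
      x ∈ Ideal.span (f '' A)) {B c : ℕ} {x : R}
    (hx : w * x ∈ powerProductIdeal f (deficitSet s B k c)) :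
    x ∈ powerProductIdeal f (deficitSet s B k c) := by
  have h := isWeaklyRegular_graphSequence_deficitSet hk hf hw B c
  rw [isWeaklyRegular_quotient_iff] at h
  have h1 := h s (by simp [graphSequence]) (C x)
  rw [List.getElem_append_right (by simp [graphSequence]),
    List.take_append_of_le_length (by simp [graphSequence]),
    List.take_of_length_le (by simp [graphSequence])] at h1
  simp only [List.getElem_singleton, ← C_mul, C_mem_sup_ofList_iff] at h1
  exact h1 hx

end ExponentIdeal

/-! ### Fold product ideals and their powers -/

section TotalDeficit

variable {s : ℕ} {R : Type*} [CommRing R]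

/-- Exponents of the monomials whose deficits `B - w_i` have sum at most `c`. -/
def totalDeficitSet (s B c : ℕ) : Set (Fin s →₀ ℕ) := {w | ∑ i, (B - w i) ≤ c}

theorem totalDeficitSet_subset_deficitSet (B k c : ℕ) :
    totalDeficitSet s B c ⊆ deficitSet s B k c := fun _ hw A _ =>
  (Finset.sum_le_sum_of_subset A.subset_univ).trans hw

/-- If `k` deficits were positive, they would sum to at least `k`. Hence some `k`-set contains all
positive ones. -/
theorem deficitSet_eq_totalDeficitSet {k : ℕ} (hk : k ≤ s) (hk1 : 1 ≤ k) (B : ℕ) :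
    deficitSet s B k (k - 1) = totalDeficitSet s B (k - 1) := by
  refine Set.Subset.antisymm (fun w hw => ?_) (totalDeficitSet_subset_deficitSet B k _)
  let P : Finset (Fin s) := Finset.univ.filter fun i => 0 < B - w i
  rcases le_total k P.card with h | h
  · obtain ⟨A, hAP, hA⟩ := Finset.exists_subset_card_eq h
    have h1 := hw A hA
    have h2 : A.card • 1 ≤ ∑ i ∈ A, (B - w i) :=
      Finset.card_nsmul_le_sum A _ 1 fun i hi => (Finset.mem_filter.1 (hAP hi)).2
    simp only [smul_eq_mul, mul_one] at h2
    omega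
  · obtain ⟨A, hPA, -, hA⟩ := Finset.exists_subsuperset_card_eq P.subset_univ h (by simpa using hk)
    refine le_of_eq_of_le (Finset.sum_subset A.subset_univ fun i _ hi => ?_).symm (hw A hA)
    by_contra h0
    exact hi (hPA (Finset.mem_filter.2 ⟨Finset.mem_univ i, Nat.pos_of_ne_zero h0⟩))

theorem exists_le_sum_eq {ι : Type*} (A : Finset ι) (v : ι → ℕ) (a : ℕ) (h : a ≤ ∑ i ∈ A, v i) :
    ∃ e : ι → ℕ, (∀ i, e i ≤ v i) ∧ ∑ i ∈ A, e i = a := by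
  classical
  induction A using Finset.induction_on generalizing a with
  | empty => exact ⟨0, fun i => Nat.zero_le _, by simpa [eq_comm] using h⟩
  | insert j A hj ih =>
    rw [Finset.sum_insert hj] at h
    obtain ⟨e, he, hs⟩ := ih (a - v j) (by omega)
    refine ⟨Function.update e j (min a (v j)), fun i => ?_, ?_⟩
    · by_cases hi : i = j
      · subst hi
        simp
      · simpa [hi] using he i
    · rw [Finset.sum_insert hj, Function.update_self, Finset.sum_update_of_notMem hj, hs]
      omega

/-- Total deficit at most `sb - a` means ∑ min(w_i, b) ≥ a, so the product is a multiple of a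
generator. -/
theorem foldProductIdeal_eq_powerProductIdeal (f : Fin s → R) {a b : ℕ} (ha : a ≤ s * b) :
    foldProductIdeal f (fun _ => b) a = powerProductIdeal f (totalDeficitSet s b (s * b - a)) := by
  apply le_antisymm
  · refine Ideal.span_mono ?_
    rintro _ ⟨e, he, hsum, rfl⟩
    refine ⟨Finsupp.equivFunOnFinite.symm e, ?_, rfl⟩
    have h1 : ∑ i, (b - e i) + ∑ i, e i = s * b := by
      rw [← Finset.sum_add_distrib, Finset.sum_congr rfl fun i _ => Nat.sub_add_cancel (he i)]
      simp
    change ∑ i, (b - e i) ≤ _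
    omega
  · refine Ideal.span_le.2 ?_
    rintro _ ⟨w, hw, rfl⟩
    have h1 : ∑ i, (b - w i) + ∑ i, min (w i) b = s * b := by
      rw [← Finset.sum_add_distrib,
        Finset.sum_congr rfl fun i _ => show b - w i + min (w i) b = b by omega]
      simp
    have hw' : ∑ i, (b - w i) ≤ s * b - a := hw
    obtain ⟨e, he, hsum⟩ := exists_le_sum_eq Finset.univ (fun i => min (w i) b) a (by omega)
    have h2 : ∏ i, f i ^ w i = (∏ i, f i ^ (w i - e i)) * ∏ i, f i ^ e i := by
      rw [← Finset.prod_mul_distrib]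
      refine Finset.prod_congr rfl fun i _ => ?_
      rw [← pow_add, Nat.sub_add_cancel ((he i).trans (min_le_left _ _))]
    simp only [SetLike.mem_coe, h2]
    exact Ideal.mul_mem_left _ _
      (Ideal.subset_span ⟨e, fun i => (he i).trans (min_le_right _ _), hsum, rfl⟩)

/-- Let each new value be the increment of the rounded-down partial sums; it lies between the two
roundings of v_j / M. -/
theorem exists_balanced {ι : Type*} (A : Finset ι) (v : ι → ℕ) (M : ℕ) (hM : 0 < M) :
    ∃ x : ι → ℕ, (∀ i, v i / M ≤ x i ∧ x i ≤ (v i + (M - 1)) / M) ∧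
      ∑ i ∈ A, x i = (∑ i ∈ A, v i) / M := by
  classical
  induction A using Finset.induction_on with
  | empty => exact ⟨fun i => v i / M, fun i => ⟨le_rfl, Nat.div_le_div_right (by omega)⟩, by simp⟩
  | insert j A hj ih =>
    obtain ⟨x, hx, hs⟩ := ih
    generalize hV : ∑ i ∈ A, v i = V at hs
    have h1 : V / M + v j / M ≤ (V + v j) / M := Nat.div_add_div_le_add_div
    have h2 : (V + v j) / M ≤ V / M + (v j + (M - 1)) / M := by
      rw [← Nat.add_mul_div_left _ _ hM |>.trans (add_comm _ _)]
      refine Nat.div_le_div_right ?_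
      have h3 := Nat.div_add_mod V M
      have h4 := Nat.mod_lt V hM
      omega
    refine ⟨Function.update x j ((V + v j) / M - V / M), fun i => ?_, ?_⟩
    · by_cases hi : i = j
      · subst hi
        rw [Function.update_self]
        exact ⟨Nat.le_sub_of_add_le' h1, Nat.sub_le_iff_le_add'.2 h2⟩
      · simpa [hi] using hx i
    · rw [Finset.sum_insert hj, Function.update_self, Finset.sum_update_of_notMem hj, hs,
        Finset.sum_insert hj, hV, add_comm (v j)]
      exact Nat.sub_add_cancel ((Nat.le_add_right _ _).trans h1)

theorem div_bounds {v b m : ℕ} (h : v ≤ (m + 1) * b) :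
    (v + m) / (m + 1) ≤ b ∧ v - v / (m + 1) ≤ m * b := by
  constructor
  · rw [← Nat.lt_succ_iff, Nat.div_lt_iff_lt_mul (Nat.succ_pos m)]
    nlinarith
  · have h1 := Nat.div_add_mod v (m + 1)
    have h2 := Nat.mod_lt v (Nat.succ_pos m)
    set q := v / (m + 1)
    set r := v % (m + 1)
    rcases lt_or_ge q b with h3 | h3
    · have : m * (q + 1) ≤ m * b := Nat.mul_le_mul_left m h3
      have h4 : v = m * q + q + r := by rw [← h1]; ring
      have h5 : m * (q + 1) = m * q + m := by ring
      omega
    · have : (m + 1) * b ≤ (m + 1) * q := Nat.mul_le_mul_left _ h3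
      have h6 : r = 0 := by omega
      have h7 : q ≤ b := by
        by_contra! h8
        have := Nat.mul_lt_mul_of_pos_left h8 (show 0 < m + 1 from Nat.succ_pos m)
        omega
      have h8 : q = b := le_antisymm h7 h3
      have h9 : v = m * b + b := by rw [← h1, h6, h8]; ring
      omega

/-- Multiplication adds deficit bounds. Conversely, one factor splits off by taking a share 1/(m+1)
of every deficit, rounded so that the total is rounded down; both factors then meet their bounds. -/
theorem powerProductIdeal_totalDeficitSet_pow (f : Fin s → R) (b c m : ℕ) :
    powerProductIdeal f (totalDeficitSet s b c) ^ m =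
      powerProductIdeal f (totalDeficitSet s (m * b) (m * c)) := by
  induction m with
  | zero =>
    rw [pow_zero, Ideal.one_eq_top, eq_comm]
    exact Ideal.eq_top_of_isUnit_mem _ (Ideal.subset_span ⟨0, by simp [totalDeficitSet], rfl⟩)
      (by simp)
  | succ m ih =>
    rw [pow_succ, ih, powerProductIdeal, powerProductIdeal, Ideal.span_mul_span']
    apply le_antisymm
    · refine Ideal.span_mono ?_
      rintro _ ⟨_, ⟨w, hw, rfl⟩, _, ⟨w', hw', rfl⟩, rfl⟩
      refine ⟨w + w', ?_, ?_⟩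
      · have h1 : ∑ i, ((m + 1) * b - (w + w') i) ≤ ∑ i, (m * b - w i) + ∑ i, (b - w' i) := by
          rw [← Finset.sum_add_distrib]
          refine Finset.sum_le_sum fun i _ => ?_
          rw [Finsupp.add_apply, add_mul, one_mul]
          omega
        have h2 : ∑ i, (m * b - w i) ≤ m * c := hw
        have h3 : ∑ i, (b - w' i) ≤ c := hw'
        change _ ≤ (m + 1) * c
        rw [add_mul m 1 c, one_mul]
        omega
      · simp only [Finsupp.add_apply, pow_add, Finset.prod_mul_distrib]
    · refine Ideal.span_mono ?_
      rintro _ ⟨w, hw, rfl⟩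
      have hw' : ∑ i, ((m + 1) * b - w i) ≤ (m + 1) * c := hw
      obtain ⟨x, hx, hsum⟩ := exists_balanced Finset.univ (fun i => (m + 1) * b - w i) (m + 1)
        (Nat.succ_pos m)
      simp only [Nat.add_sub_cancel] at hx
      have hb : ∀ i, x i ≤ b ∧ ((m + 1) * b - w i) - x i ≤ m * b := fun i => by
        have h1 := div_bounds (v := (m + 1) * b - w i) (b := b) (m := m) (by omega)
        have h2 := hx i
        exact ⟨h2.2.trans h1.1, (Nat.sub_le_sub_left h2.1 _).trans h1.2⟩
      have hle : ∀ i, b - x i ≤ w i := fun i => by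
        have h1 := hb i
        rw [add_mul, one_mul] at h1
        omega
      -- The split-off factor has exponent `b - x i`, hence deficit `x i`; the other keeps the
      -- remaining deficit.
      refine ⟨_, ⟨Finsupp.equivFunOnFinite.symm fun i => w i - (b - x i), ?_, rfl⟩, _,
        ⟨Finsupp.equivFunOnFinite.symm fun i => b - x i, ?_, rfl⟩, ?_⟩
      · change ∑ i, (m * b - (w i - (b - x i))) ≤ m * c
        have h1 : ∑ i, (m * b - (w i - (b - x i))) + ∑ i, x i = ∑ i, ((m + 1) * b - w i) := by
          rw [← Finset.sum_add_distrib]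
          refine Finset.sum_congr rfl fun i _ => ?_
          have h1 := hb i
          have h2 := hle i
          have h3 : x i ≤ (m + 1) * b - w i := by
            refine (hx i).2.trans ?_
            rcases Nat.eq_zero_or_pos ((m + 1) * b - w i) with h | h
            · rw [h, zero_add, Nat.div_eq_of_lt (Nat.lt_succ_self m)]
            · rw [← Nat.lt_succ_iff, Nat.div_lt_iff_lt_mul (Nat.succ_pos m)]
              nlinarith
          rw [add_mul, one_mul] at h1 h3 ⊢
          omega
        have h2 := (div_bounds hw').2
        rw [← hsum] at h2
        omega
      · change ∑ i, (b - (b - x i)) ≤ c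
        rw [Finset.sum_congr rfl fun i _ => Nat.sub_sub_self (hb i).1, hsum]
        exact (Nat.div_le_div_right (Nat.le_add_right _ m)).trans (div_bounds hw').1
      · simp only [Finsupp.equivFunOnFinite_symm_apply_apply]
        rw [← Finset.prod_mul_distrib]
        refine Finset.prod_congr rfl fun i _ => ?_
        rw [← pow_add, Nat.sub_add_cancel (hle i)]

end TotalDeficit

/-! ### Nonzerodivisors modulo powers of generic elements -/

section RegularMod

variable {R : Type*} [CommRing R]

/-- Multiplication by `w` is injective modulo `J`. -/
def RegularMod (J : Ideal R) (w : R) : Prop := ∀ x, w * x ∈ J → x ∈ J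

theorem regularMod_iff {J : Ideal R} {w : R} : RegularMod J w ↔ IsSMulRegular (R ⧸ J) w := by
  rw [isSMulRegular_quotient_iff_mem_of_smul_mem]
  rfl

theorem RegularMod.mul {J : Ideal R} {w w' : R} (h : RegularMod J w) (h' : RegularMod J w') :
    RegularMod J (w * w') := fun x hx => h' x (h _ (by rwa [← mul_assoc]))

theorem RegularMod.pow {J : Ideal R} {w : R} (h : RegularMod J w) (t : ℕ) :
    RegularMod J (w ^ t) := by
  induction t with
  | zero => intro x hx; simpa using hx
  | succ t ih => exact pow_succ w t ▸ ih.mul h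

theorem RegularMod.prod {ι : Type*} {J : Ideal R} {A : Finset ι} {w : ι → R}
    (h : ∀ i ∈ A, RegularMod J (w i)) : RegularMod J (∏ i ∈ A, w i) := by
  classical
  induction A using Finset.induction_on with
  | empty => intro x hx; simpa using hx
  | insert j A hj ih =>
    rw [Finset.prod_insert hj]
    exact (h j (Finset.mem_insert_self _ _)).mul
      (ih fun i hi => h i (Finset.mem_insert_of_mem hi))

/-- Write x = j + yg. Cancelling `g` modulo `J` turns fx ∈ J + (g^{t+1}) into fy ∈ J + (g^t), and
induction applies to y. -/
theorem RegularMod.sup_span_pow {J : Ideal R} {f g : R} (hf : RegularMod (J ⊔ Ideal.span {g}) f)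
    (hg : RegularMod J g) (t : ℕ) : RegularMod (J ⊔ Ideal.span {g ^ t}) f := by
  induction t with
  | zero => intro x _; simp
  | succ t ih =>
    intro x hx
    have hle : J ⊔ Ideal.span {g ^ (t + 1)} ≤ J ⊔ Ideal.span {g} :=
      sup_le_sup_left (Ideal.span_singleton_le_span_singleton.2 (dvd_pow_self g (Nat.succ_ne_zero t))) _
    obtain ⟨j, hj, z, hz, rfl⟩ := Submodule.mem_sup.1 (hf x (hle hx))
    obtain ⟨y, rfl⟩ := Ideal.mem_span_singleton'.1 hz
    obtain ⟨j', hj', z', hz', h⟩ := Submodule.mem_sup.1 hx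
    obtain ⟨q, rfl⟩ := Ideal.mem_span_singleton'.1 hz'
    have h1 : g * (f * y - q * g ^ t) ∈ J := by
      have : g * (f * y - q * g ^ t) = j' - f * j := by linear_combination -h
      rw [this]
      exact J.sub_mem hj' (J.mul_mem_left _ hj)
    have h2 : f * y ∈ J ⊔ Ideal.span {g ^ t} := by
      have := Ideal.add_mem _ (Ideal.mem_sup_left (hg _ h1))
        (Ideal.mem_sup_right (Ideal.mem_span_singleton'.2 ⟨q, rfl⟩ :
          q * g ^ t ∈ Ideal.span {g ^ t}))
      simpa using this
    obtain ⟨a, ha, b, hb, rfl⟩ := Submodule.mem_sup.1 (ih y h2)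
    obtain ⟨c, rfl⟩ := Ideal.mem_span_singleton'.1 hb
    refine Submodule.mem_sup.2 ⟨j + a * g, J.add_mem hj (J.mul_mem_right _ ha), c * g ^ (t + 1),
      Ideal.mem_span_singleton'.2 ⟨c, rfl⟩, by ring⟩

variable {s k : ℕ} {f : Fin s → R}

theorem span_image_insert {ι : Type*} [DecidableEq ι] (g : ι → R) (j : ι) (A : Finset ι) :
    Ideal.span (g '' (insert j A : Finset ι)) = Ideal.span (g '' A) ⊔ Ideal.span {g j} := by
  rw [Finset.coe_insert, Set.image_insert_eq, Ideal.span_insert, sup_comm]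

theorem IsRegularModOthers.regularMod_sup_pow (hf : IsRegularModOthers f k) (b : ℕ)
    (A₁ A₂ : Finset (Fin s)) (hd : Disjoint A₁ A₂) (hc : A₁.card + A₂.card ≤ k) (j : Fin s)
    (hj₁ : j ∉ A₁) (hj₂ : j ∉ A₂) :
    RegularMod (Ideal.span (f '' A₁) ⊔ Ideal.span ((fun i => f i ^ b) '' A₂)) (f j) := by
  induction A₂ using Finset.induction_on generalizing A₁ j with
  | empty => simpa [RegularMod] using hf A₁ j hj₁ (by simpa using hc)
  | insert i A hi ih =>
    rw [Finset.card_insert_of_notMem hi] at hc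
    rw [Finset.disjoint_insert_right] at hd
    rw [Finset.mem_insert, not_or] at hj₂
    rw [span_image_insert, ← sup_assoc]
    refine RegularMod.sup_span_pow ?_ (ih A₁ hd.2 (by omega) i hd.1 hi) b
    have h1 := ih (insert i A₁) (Finset.disjoint_insert_left.2 ⟨hi, hd.2⟩)
      (by rw [Finset.card_insert_of_notMem hd.1]; omega) j
      (by simp [hj₁, hj₂.1]) hj₂.2
    rwa [span_image_insert, sup_right_comm] at h1

/-- Cancel f_i^{b-1} modulo the other generators, which trades f_i^b for f_i. At most `k` generators
remain beside the i-th, hence the bound `k + 1`. -/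
theorem IsRegularModOthers.mem_of_mul_prod_mem (hf : IsRegularModOthers f k) {b : ℕ} (hb : 1 ≤ b)
    (A₁ A₂ : Finset (Fin s)) (hd : Disjoint A₁ A₂) (hc : A₁.card + A₂.card ≤ k + 1) (x : R)
    (hx : (∏ i ∈ A₂, f i ^ (b - 1)) * x ∈
      Ideal.span (f '' A₁) ⊔ Ideal.span ((fun i => f i ^ b) '' A₂)) :
    x ∈ Ideal.span (f '' (A₁ ∪ A₂ : Finset (Fin s))) := by
  induction A₂ using Finset.induction_on generalizing A₁ with
  | empty => simpa using hx
  | insert i A hi ih =>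
    rw [Finset.card_insert_of_notMem hi] at hc
    rw [Finset.disjoint_insert_right] at hd
    have h1 : RegularMod (Ideal.span (f '' A₁) ⊔ Ideal.span ((fun i => f i ^ b) '' A)) (f i) :=
      hf.regularMod_sup_pow b A₁ A hd.2 (by omega) i hd.1 hi
    rw [Finset.prod_insert hi, span_image_insert, ← sup_assoc] at hx
    obtain ⟨j, hj, z, hz, h⟩ := Submodule.mem_sup.1 hx
    obtain ⟨q, rfl⟩ := Ideal.mem_span_singleton'.1 hz
    have h2 := h1.pow (b - 1) ((∏ i ∈ A, f i ^ (b - 1)) * x - q * f i) (by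
      have h3 : f i ^ b = f i ^ (b - 1) * f i := by rw [← pow_succ, Nat.sub_add_cancel hb]
      rw [h3] at h
      have : f i ^ (b - 1) * ((∏ i ∈ A, f i ^ (b - 1)) * x - q * f i) = j := by
        linear_combination -h
      rwa [this])
    have h4 := ih (insert i A₁) (Finset.disjoint_insert_left.2 ⟨hi, hd.2⟩)
      (by rw [Finset.card_insert_of_notMem hd.1]; omega) (by
        rw [span_image_insert, sup_right_comm]
        have := Ideal.add_mem _ (Ideal.mem_sup_left h2)
          (Ideal.mem_sup_right (Ideal.mem_span_singleton'.2 ⟨q, rfl⟩ :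
            q * f i ∈ Ideal.span {f i}))
        rwa [sub_add_cancel] at this)
    rwa [show A₁ ∪ insert i A = insert i A₁ ∪ A by simp]

/-- A nonzerodivisor modulo `I_a(f_1^b ⋯ f_s^b)` is one modulo any `k` of the `f_i`. -/
theorem IsRegularModOthers.regularMod_span_of_powerProductIdeal (hf : IsRegularModOthers f k)
    (hk1 : 1 ≤ k) {b : ℕ} (hb : 1 ≤ b) {w : R}
    (hw : RegularMod (powerProductIdeal f (totalDeficitSet s b (k - 1))) w)
    {A : Finset (Fin s)} (hA : A.card = k) : RegularMod (Ideal.span (f '' A)) w := by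
  intro x hx
  -- This `y` multiplies (f_i : i ∈ A) into I_a, since y f_i has deficit 1 at exactly the `k - 1`
  -- other indices of `A`; it can be cancelled again modulo (f_i^b : i ∈ A).
  set y := (∏ i ∈ A, f i ^ (b - 1)) * ∏ i ∈ Aᶜ, f i ^ b with hy
  have h1 : ∀ i ∈ A, y * f i ∈ powerProductIdeal f (totalDeficitSet s b (k - 1)) := by
    intro i hi
    have h2 : y * f i = ∏ j, f j ^ (if j ∈ A.erase i then b - 1 else b) := by
      have e1 : ∏ j ∈ A.erase i, f j ^ (if j ∈ A.erase i then b - 1 else b) =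
          ∏ j ∈ A.erase i, f j ^ (b - 1) := Finset.prod_congr rfl fun j hj => by rw [if_pos hj]
      have e2 : ∏ j ∈ Aᶜ, f j ^ (if j ∈ A.erase i then b - 1 else b) = ∏ j ∈ Aᶜ, f j ^ b :=
        Finset.prod_congr rfl fun j hj => by
          rw [if_neg fun h => Finset.mem_compl.1 hj (Finset.mem_of_mem_erase h)]
      rw [hy, ← Finset.prod_mul_prod_compl A (fun j => f j ^ (if j ∈ A.erase i then b - 1 else b)),
        ← Finset.mul_prod_erase A (fun j => f j ^ (b - 1)) hi,
        ← Finset.mul_prod_erase A (fun j => f j ^ (if j ∈ A.erase i then b - 1 else b)) hi, e1, e2]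
      simp only [Finset.mem_erase, ne_eq, not_true_eq_false, false_and, if_false]
      have h3 : f i ^ b = f i ^ (b - 1) * f i := by rw [← pow_succ, Nat.sub_add_cancel hb]
      rw [h3]
      ring
    rw [h2]
    refine Ideal.subset_span
      ⟨Finsupp.equivFunOnFinite.symm fun j => if j ∈ A.erase i then b - 1 else b, ?_, rfl⟩
    change ∑ j, (b - (if j ∈ A.erase i then b - 1 else b)) ≤ k - 1
    rw [Finset.sum_congr (g := fun j => if j ∈ A.erase i then 1 else 0) rfl fun j _ => by
      split_ifs <;> omega]
    rw [Finset.sum_boole, Finset.filter_mem_eq_inter, Finset.univ_inter,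
      Finset.card_erase_of_mem hi, hA, Nat.cast_id]
  have h2 : y * (w * x) ∈ powerProductIdeal f (totalDeficitSet s b (k - 1)) := by
    have hle : Ideal.span (f '' A) ≤
        Submodule.comap (LinearMap.mulLeft R y)
          (powerProductIdeal f (totalDeficitSet s b (k - 1))) := by
      refine Ideal.span_le.2 ?_
      rintro _ ⟨i, hi, rfl⟩
      exact h1 i hi
    exact hle hx
  have h3 := hw (y * x) (by rwa [mul_left_comm])
  -- Among `k` deficits of sum at most `k - 1`, one is zero.
  have h4 : powerProductIdeal f (totalDeficitSet s b (k - 1)) ≤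
      Ideal.span ((fun i => f i ^ b) '' A) := by
    refine Ideal.span_le.2 ?_
    rintro _ ⟨w, hw, rfl⟩
    obtain ⟨i, hi, hib⟩ : ∃ i ∈ A, b ≤ w i := by
      by_contra! h
      have h5 : A.card • 1 ≤ ∑ i ∈ A, (b - w i) :=
        Finset.card_nsmul_le_sum A _ 1 fun i hi => by have := h i hi; omega
      have h6 := totalDeficitSet_subset_deficitSet b k _ hw A hA
      simp only [smul_eq_mul, mul_one] at h5
      omega
    refine Ideal.mem_of_dvd _ ((pow_dvd_pow (f i) hib).trans
      (Finset.dvd_prod_of_mem (fun i => f i ^ w i) (Finset.mem_univ i)))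
      (Ideal.subset_span ⟨i, hi, rfl⟩)
  have h5 := hf.mem_of_mul_prod_mem hb ∅ A (Finset.disjoint_empty_left A) (by simp [hA])
    ((∏ i ∈ Aᶜ, f i ^ b) * x) (by
      simpa [hy, mul_assoc] using h4 h3)
  rw [Finset.empty_union] at h5
  exact RegularMod.prod (fun i hi =>
    RegularMod.pow (fun x => hf A i (Finset.mem_compl.1 hi) hA.le x) b) x h5

end RegularMod

/-! ### Descent to fewer generators by degree -/

section Graded

attribute [local instance] MvPolynomial.gradedAlgebra

variable {K τ : Type*} [Field K] {s k d : ℕ} {f : Fin s → MvPolynomial τ K}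

theorem homogeneousComponent_mem_span {S : Set (MvPolynomial τ K)}
    (hS : ∀ g ∈ S, g.IsHomogeneous d) {p : MvPolynomial τ K} (hp : p ∈ Ideal.span S) (e : ℕ) :
    homogeneousComponent e p ∈ Ideal.span S :=
  homogeneousComponent_mem_of_mem (Ideal.homogeneous_span _ _ fun g hg => ⟨d, hS g hg⟩) hp e

theorem homogeneousComponent_mul_eq_zero {p g : MvPolynomial τ K} {e D : ℕ}
    (hg : g.IsHomogeneous D) (he : e < D) : homogeneousComponent e (p * g) = 0 := by
  have h : p * g ∈ Ideal.span {g} := Ideal.mul_mem_left _ _ (Ideal.mem_span_singleton_self g)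
  rw [← sum_homogeneousComponent p, Finset.sum_mul, map_sum]
  refine Finset.sum_eq_zero fun i _ => ?_
  rw [homogeneousComponent_of_mem ((homogeneousComponent_isHomogeneous i p).mul hg), if_neg]
  omega

/-- Dividing by `g` repeatedly puts `x` in (S) + (g^t) for every t. Once g^t has degree above that
of `x`, all components of `x` lie in (S): a graded form of Krull's intersection argument. -/
theorem regularMod_of_sup_span {S : Set (MvPolynomial τ K)} (hS : ∀ g ∈ S, g.IsHomogeneous d)
    {g w : MvPolynomial τ K} (hd : 1 ≤ d) (hgd : g.IsHomogeneous d)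
    (hg : RegularMod (Ideal.span S) g) (hw : RegularMod (Ideal.span S ⊔ Ideal.span {g}) w) :
    RegularMod (Ideal.span S) w := by
  intro x hx
  have key : ∀ t : ℕ, ∃ y q, y ∈ Ideal.span S ∧ x = y + q * g ^ t ∧ w * q ∈ Ideal.span S := by
    intro t
    induction t with
    | zero => exact ⟨0, x, Ideal.zero_mem _, by simp, hx⟩
    | succ t ih =>
      obtain ⟨y, q, hy, rfl, hq⟩ := ih
      obtain ⟨j, hj, z, hz, rfl⟩ := Submodule.mem_sup.1 (hw q (Ideal.mem_sup_left hq))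
      obtain ⟨q', rfl⟩ := Ideal.mem_span_singleton'.1 hz
      refine ⟨y + j * g ^ t, q', Ideal.add_mem _ hy (Ideal.mul_mem_right _ _ hj), by ring, ?_⟩
      refine hg _ ?_
      have : g * (w * q') = w * (j + q' * g) - w * j := by ring
      rw [this]
      exact Ideal.sub_mem _ hq (Ideal.mul_mem_left _ _ hj)
  obtain ⟨y, q, hy, hxy, -⟩ := key (x.totalDegree + 1)
  rw [← sum_homogeneousComponent x]
  refine Ideal.sum_mem _ fun e he => ?_
  have hlt : e < d * (x.totalDegree + 1) :=
    (Finset.mem_range.1 he).trans_le (Nat.le_mul_of_pos_left _ hd)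
  rw [hxy, map_add, homogeneousComponent_mul_eq_zero (hgd.pow (x.totalDegree + 1)) hlt, add_zero]
  exact homogeneousComponent_mem_span hS hy e

theorem IsRegularModOthers.regularMod_of_card_le (hf : IsRegularModOthers f k) (hd : 1 ≤ d)
    (hfd : ∀ i, (f i).IsHomogeneous d) (hk : k ≤ s) {w : MvPolynomial τ K}
    (hw : ∀ A : Finset (Fin s), A.card = k → RegularMod (Ideal.span (f '' A)) w)
    (A : Finset (Fin s)) (hA : A.card ≤ k) : RegularMod (Ideal.span (f '' A)) w := by
  induction hn : k - A.card generalizing A with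
  | zero => exact hw A (by omega)
  | succ n ih =>
    obtain ⟨j, hj⟩ : ∃ j, j ∉ A := by
      by_contra! h
      have := Finset.card_le_card (show Finset.univ ⊆ A from fun j _ => h j)
      simp at this
      omega
    have h1 := ih (insert j A) (by rw [Finset.card_insert_of_notMem hj]; omega)
      (by rw [Finset.card_insert_of_notMem hj]; omega)
    rw [span_image_insert] at h1
    refine regularMod_of_sup_span ?_ hd (hfd j) (fun x => hf A j hj hA x) h1
    rintro _ ⟨i, -, rfl⟩
    exact hfd i

end Graded

/-! ### Symbolic powers -/

section SymbolicPower

theorem mem_symbolicPower_iff {A : Type*} [CommRing A] {I : Ideal A} {m : ℕ} {x : A} :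
    x ∈ symbolicPower I m ↔ ∀ p ∈ associatedPrimes A (A ⧸ I), ∃ y ∉ p, y * x ∈ I ^ m := by
  simp only [symbolicPower, Submodule.mem_iInf, Ideal.mem_comap]
  constructor
  · intro h p hp
    have hprime := hp.isPrime
    have := h ⟨p, hp.isPrime⟩ hp
    rwa [IsLocalization.algebraMap_mem_map_algebraMap_iff (M := p.primeCompl)] at this
  · intro h p hp
    rw [IsLocalization.algebraMap_mem_map_algebraMap_iff (M := p.asIdeal.primeCompl)]
    exact h p.asIdeal hp

/-- Prime avoidance for the finitely many associated primes, whose union is the set of zero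
divisors. -/
theorem exists_regularMod_of_forall_associatedPrimes {A : Type*} [CommRing A] [IsNoetherianRing A]
    {ι : Type*} [Finite ι] (J : ι → Ideal A) (I : Ideal A)
    (h : ∀ i, ∀ p ∈ associatedPrimes A (A ⧸ J i), ¬ I ≤ p) : ∃ w ∈ I, ∀ i, RegularMod (J i) w := by
  have hfin : (⋃ i, associatedPrimes A (A ⧸ J i)).Finite :=
    Set.finite_iUnion fun i => associatedPrimes.finite A (A ⧸ J i)
  have h1 : ¬ ((I : Set A) ⊆ ⋃ p ∈ (hfin.toFinset : Set (Ideal A)), (p : Set A)) := by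
    rw [Ideal.subset_union_prime (f := fun p => p) ⊥ ⊥]
    · rintro ⟨p, hp, hle⟩
      obtain ⟨i, hi⟩ := Set.mem_iUnion.1 (hfin.mem_toFinset.1 hp)
      exact h i p hi hle
    · intro p hp _ _
      obtain ⟨i, hi⟩ := Set.mem_iUnion.1 (hfin.mem_toFinset.1 hp)
      exact hi.isPrime
  obtain ⟨w, hw, hw'⟩ := Set.not_subset.1 h1
  refine ⟨w, hw, fun i => ?_⟩
  rw [regularMod_iff]
  by_contra h2
  have h3 : w ∈ {r : A | IsSMulRegular (A ⧸ J i) r}ᶜ := h2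
  rw [← biUnion_associatedPrimes_eq_compl_regular] at h3
  obtain ⟨p, hp, hwp⟩ := Set.mem_iUnion₂.1 h3
  refine hw' (Set.mem_iUnion₂.2 ⟨p, ?_, hwp⟩)
  simpa using ⟨i, hp⟩

theorem RegularMod.notMem_associatedPrimes {A : Type*} [CommRing A] [IsNoetherianRing A]
    {J : Ideal A} {w : A} (h : RegularMod J w) {p : Ideal A}
    (hp : p ∈ associatedPrimes A (A ⧸ J)) : w ∉ p := by
  intro hw
  have h1 : w ∈ ⋃ p ∈ associatedPrimes A (A ⧸ J), (p : Set A) := Set.mem_iUnion₂.2 ⟨p, hp, hw⟩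
  rw [biUnion_associatedPrimes_eq_compl_regular] at h1
  exact h1 (regularMod_iff.1 h)

variable {K τ : Type*} [Field K] [Finite τ] {s k d : ℕ} {f : Fin s → MvPolynomial τ K}

/-- If `p` contained more than `k` of the f_j, then for each |B| ≤ k it would contain some f_j
regular modulo (f_i : i ∈ B). Prime avoidance gives one w ∈ p regular modulo all of these, hence
modulo I_a, which no element of an associated prime can be. -/
theorem exists_card_eq_of_mem_associatedPrimes (hf : IsRegularModOthers f k) (hk : k ≤ s)
    (hk1 : 1 ≤ k) {b : ℕ} {p : Ideal (MvPolynomial τ K)}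
    (hp : p ∈ associatedPrimes _
      (MvPolynomial τ K ⧸ powerProductIdeal f (totalDeficitSet s b (k - 1)))) :
    ∃ A : Finset (Fin s), A.card = k ∧ ∀ j ∉ A, f j ∉ p := by
  classical
  let P : Finset (Fin s) := Finset.univ.filter fun j => f j ∈ p
  have hP : P.card ≤ k := by
    by_contra! hlt
    obtain ⟨w, hwp, hw⟩ := exists_regularMod_of_forall_associatedPrimes
      (fun B : {B : Finset (Fin s) // B.card ≤ k} => Ideal.span (f '' B.1)) p (by
        rintro ⟨B, hB⟩ q hq hle
        obtain ⟨j, hj, hjB⟩ := Finset.exists_mem_notMem_of_card_lt_card (hB.trans_lt hlt)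
        have h1 : RegularMod (Ideal.span (f '' B)) (f j) := fun x => hf B j hjB hB x
        exact h1.notMem_associatedPrimes hq (hle (Finset.mem_filter.1 hj).2))
    have h2 : RegularMod (powerProductIdeal f (totalDeficitSet s b (k - 1))) w := by
      rw [← deficitSet_eq_totalDeficitSet hk hk1]
      exact fun x => mem_powerProductIdeal_of_mul_mem hk hf fun A hA => hw ⟨A, hA⟩
    exact h2.notMem_associatedPrimes hp hwp
  obtain ⟨A, hPA, -, hA⟩ := Finset.exists_subsuperset_card_eq P.subset_univ hP (by simpa using hk)
  exact ⟨A, hA, fun j hj hjp => hj (hPA (Finset.mem_filter.2 ⟨Finset.mem_univ j, hjp⟩))⟩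

theorem symbolicPower_powerProductIdeal (hf : IsRegularModOthers f k) (hd : 1 ≤ d)
    (hfd : ∀ i, (f i).IsHomogeneous d) (hk : k ≤ s) (hk1 : 1 ≤ k) {b : ℕ} (hb : 1 ≤ b) (m : ℕ) :
    symbolicPower (powerProductIdeal f (totalDeficitSet s b (k - 1))) m =
      powerProductIdeal f (deficitSet s (m * b) k (m * (k - 1))) := by
  apply le_antisymm
  · intro x hx
    rw [mem_symbolicPower_iff, powerProductIdeal_totalDeficitSet_pow] at hx
    -- The colon ideal (I^m : x) lies in no associated prime of I, so it contains a nonzerodivisor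
    -- modulo I.
    obtain ⟨w, hw, hreg⟩ := exists_regularMod_of_forall_associatedPrimes
      (fun _ : Unit => powerProductIdeal f (totalDeficitSet s b (k - 1)))
      (Submodule.comap (LinearMap.mulRight _ x)
        (powerProductIdeal f (totalDeficitSet s (m * b) (m * (k - 1))))) (by
        rintro - p hp hle
        obtain ⟨y, hyp, hy⟩ := hx p hp
        exact hyp (hle hy))
    refine mem_powerProductIdeal_of_mul_mem hk hf (w := w)
      (hf.regularMod_of_card_le hd hfd hk fun A hA =>
        hf.regularMod_span_of_powerProductIdeal hk1 hb (hreg ()) hA) ?_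
    exact powerProductIdeal_mono (totalDeficitSet_subset_deficitSet _ _ _) hw
  · refine Ideal.span_le.2 ?_
    rintro _ ⟨w, hw, rfl⟩
    rw [SetLike.mem_coe, mem_symbolicPower_iff, powerProductIdeal_totalDeficitSet_pow]
    intro p hp
    obtain ⟨A, hA, hAp⟩ := exists_card_eq_of_mem_associatedPrimes hf hk hk1 hp
    have hprime := hp.isPrime
    -- This multiplier, not in `p`, clears all deficits outside `A`; the rest is one k-fold sum.
    refine ⟨∏ j ∈ Aᶜ, f j ^ (m * b), fun h => ?_, ?_⟩
    · obtain ⟨j, hj, hjp⟩ := (hprime.prod_mem_iff).1 h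
      exact hAp j (Finset.mem_compl.1 hj) (hprime.mem_of_pow_mem _ hjp)
    · have e1 : (∏ j ∈ Aᶜ, f j ^ (m * b)) * ∏ i, f i ^ w i =
          ∏ i, f i ^ ((if i ∈ A then 0 else m * b) + w i) := by
        simp only [pow_add, Finset.prod_mul_distrib]
        congr 1
        rw [← Finset.prod_subset Aᶜ.subset_univ fun i _ hi => by
          rw [if_pos (by simpa using hi), pow_zero]]
        exact Finset.prod_congr rfl fun i hi => by rw [if_neg (Finset.mem_compl.1 hi)]
      simp only [e1]
      refine Ideal.subset_span ⟨Finsupp.equivFunOnFinite.symm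
        fun i => (if i ∈ A then 0 else m * b) + w i, ?_, rfl⟩
      change ∑ i, (m * b - ((if i ∈ A then 0 else m * b) + w i)) ≤ _
      rw [← Finset.sum_subset A.subset_univ fun i _ hi => by rw [if_neg hi]; omega]
      refine le_of_eq_of_le (Finset.sum_congr rfl fun i hi => ?_) (hw A hA)
      rw [if_pos hi, zero_add]

end SymbolicPower

/-! ### Base change of flat resolutions -/

section BaseChange

open RingTheory.Sequence Function

variable {T S R : Type*} [CommRing T] [CommRing S] [CommRing R] [Algebra T S] [Algebra T R]

theorem mem_smul_top_of_rTensor_eq_zero {N : Type*} [AddCommGroup N] [Module T N]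
    (ev : S →ₐ[T] R) (hev : Surjective ev) {I : Ideal S} (hI : ∀ x, ev x = 0 → x ∈ I)
    (x : S ⊗[T] N) (hx : ev.toLinearMap.rTensor N x = 0) :
    x ∈ (I • ⊤ : Submodule S (S ⊗[T] N)) := by
  have h1 := rTensor_exact N (LinearMap.exact_subtype_ker_map ev.toLinearMap) hev
  obtain ⟨y, rfl⟩ := (h1 x).1 hx
  induction y using TensorProduct.induction_on with
  | zero => simp
  | tmul a n =>
    rw [LinearMap.rTensor_tmul]
    have h2 : (LinearMap.ker ev.toLinearMap).subtype a ⊗ₜ[T] n =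
        (a : S) • ((1 : S) ⊗ₜ[T] n) := by
      rw [TensorProduct.smul_tmul', smul_eq_mul, mul_one]
      rfl
    rw [h2]
    exact Submodule.smul_mem_smul (hI _ a.2) trivial
  | add y z hy hz =>
    rw [map_add]
    refine Submodule.add_mem _ (hy ?_) (hz ?_)
    · exact (h1 _).2 ⟨y, rfl⟩
    · exact (h1 _).2 ⟨z, rfl⟩

theorem rTensor_eq_zero_of_mem_smul_top {N : Type*} [AddCommGroup N] [Module T N]
    (ev : S →ₐ[T] R) {I : Ideal S} (hI : ∀ x ∈ I, ev x = 0)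
    (x : S ⊗[T] N) (hx : x ∈ (I • ⊤ : Submodule S (S ⊗[T] N))) :
    ev.toLinearMap.rTensor N x = 0 := by
  induction hx using Submodule.smul_induction_on' with
  | smul a ha y _ =>
    induction y using TensorProduct.induction_on with
    | zero => simp
    | tmul b n => simp [TensorProduct.smul_tmul', hI a ha]
    | add y z hy hz => rw [smul_add, map_add, hy trivial, hz trivial, add_zero]
  | add y _ z _ hy hz => rw [map_add, hy, hz, add_zero]

theorem rTensor_baseChange_apply {N N' : Type*} [AddCommGroup N] [Module T N] [AddCommGroup N']
    [Module T N'] (ev : S →ₐ[T] R) (f : N →ₗ[T] N') (x : S ⊗[T] N) :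
    ev.toLinearMap.rTensor N' (f.baseChange S x) =
      f.baseChange R (ev.toLinearMap.rTensor N x) := by
  induction x using TensorProduct.induction_on with
  | zero => simp
  | tmul a n => simp
  | add y z hy hz => rw [map_add, map_add, hy, hz, map_add, map_add]

theorem isWeaklyRegular_tensor_of_flat {rs : List S} (h : IsWeaklyRegular S rs) (N : Type*)
    [AddCommGroup N] [Module T N] [Module.Flat T N] : IsWeaklyRegular (S ⊗[T] N) rs :=
  ((TensorProduct.lid S (S ⊗[T] N)).isWeaklyRegular_congr rs).1
    (h.isWeaklyRegular_rTensor (M₂ := S ⊗[T] N))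

variable [Module.Flat T S]

/-- Exactness over S comes from flatness. It survives reduction modulo `rs` by regularity on the
cokernel of `g`, and S ⊗ M modulo `rs` is R ⊗ M. -/
theorem exact_baseChange_of_isWeaklyRegular_coker {M M₂ M₃ : Type*} [AddCommGroup M] [AddCommGroup M₂]
    [AddCommGroup M₃] [Module T M] [Module T M₂] [Module T M₃] {f : M →ₗ[T] M₂} {g : M₂ →ₗ[T] M₃}
    (hfg : Exact f g) {rs : List S} (ev : S →ₐ[T] R) (hev : Surjective ev)
    (hrs : ∀ x, ev x = 0 ↔ x ∈ Ideal.ofList rs)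
    (h : IsWeaklyRegular (S ⊗[T] (M₃ ⧸ LinearMap.range g)) rs) :
    Exact (f.baseChange R) (g.baseChange R) := by
  have h1 : Exact (f.baseChange S) (g.baseChange S) := Module.Flat.lTensor_exact S hfg
  have h2 : Exact (g.baseChange S) ((LinearMap.range g).mkQ.baseChange S) :=
    Module.Flat.lTensor_exact S (LinearMap.exact_map_mkQ_range g)
  have h3 : Surjective ((LinearMap.range g).mkQ.baseChange S) :=
    LinearMap.lTensor_surjective S (Submodule.mkQ_surjective _)
  have h4 := map_first_exact_on_four_term_right_exact_of_isSMulRegular_last h1 h2 h3 h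
  intro y
  constructor
  · intro hy
    obtain ⟨y, rfl⟩ := LinearMap.rTensor_surjective M₂ (g := ev.toLinearMap) hev y
    rw [← rTensor_baseChange_apply] at hy
    have h5 := mem_smul_top_of_rTensor_eq_zero ev hev (fun x => (hrs x).1) _ hy
    obtain ⟨x, hx⟩ := (h4 (Submodule.Quotient.mk y)).1 (by
      rw [Submodule.mapQ_apply, Submodule.Quotient.mk_eq_zero]
      exact h5)
    obtain ⟨x, rfl⟩ := Submodule.Quotient.mk_surjective _ x
    rw [Submodule.mapQ_apply, Submodule.Quotient.eq] at hx
    have h6 := rTensor_eq_zero_of_mem_smul_top ev (fun x => (hrs x).2) _ hx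
    rw [map_sub, sub_eq_zero, rTensor_baseChange_apply] at h6
    exact ⟨_, h6⟩
  · rintro ⟨x, rfl⟩
    have h7 : g ∘ₗ f = 0 := LinearMap.ext hfg.apply_apply_eq_zero
    rw [← LinearMap.comp_apply, ← LinearMap.baseChange_comp, h7, LinearMap.baseChange_zero,
      LinearMap.zero_apply]

/-- The cokernel of `f` is the image of `g`, the kernel of M₃ → coker g. -/
theorem isWeaklyRegular_tensor_coker_of_exact {M M₂ M₃ : Type*} [AddCommGroup M] [AddCommGroup M₂]
    [AddCommGroup M₃] [Module T M] [Module T M₂] [Module T M₃] {f : M →ₗ[T] M₂} {g : M₂ →ₗ[T] M₃}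
    [Module.Flat T M₃] (hfg : Exact f g) {rs : List S} (hS : IsWeaklyRegular S rs)
    (h : IsWeaklyRegular (S ⊗[T] (M₃ ⧸ LinearMap.range g)) rs) :
    IsWeaklyRegular (S ⊗[T] (M₂ ⧸ LinearMap.range f)) rs := by
  let g' : (M₂ ⧸ LinearMap.range f) →ₗ[T] M₃ :=
    (LinearMap.range f).liftQ g hfg.linearMap_ker_eq.ge
  have hg' : Injective g' := LinearMap.ker_eq_bot.1
    (Submodule.ker_liftQ_eq_bot' _ _ hfg.linearMap_ker_eq.symm)
  have hr : LinearMap.range g' = LinearMap.range g := Submodule.range_liftQ _ _ _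
  have hex : Exact g' (LinearMap.range g).mkQ := by
    rw [LinearMap.exact_iff, Submodule.ker_mkQ, hr]
  exact isWeaklyRegular_left_of_exact (f := g'.baseChange S)
    (g := (LinearMap.range g).mkQ.baseChange S) (Module.Flat.lTensor_preserves_injective_linearMap g' hg')
    (Module.Flat.lTensor_exact S hex) (LinearMap.lTensor_surjective S (Submodule.mkQ_surjective _))
    (isWeaklyRegular_tensor_of_flat hS M₃) h

/-- Base change along `ev : S → R`, with kernel generated by a sequence which is regular on `S` and
on `S ⧸ I S`, preserves exactness of flat resolutions of `T ⧸ I`. -/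
theorem exact_baseChange_of_resolution {I : Ideal T} {rs : List S} (ev : S →ₐ[T] R)
    (hev : Surjective ev) (hrs : ∀ x, ev x = 0 ↔ x ∈ Ideal.ofList rs)
    (hS : IsWeaklyRegular S rs) (hI : IsWeaklyRegular (S ⧸ I.map (algebraMap T S)) rs)
    {F : ℕ → Type*} [∀ i, AddCommGroup (F i)] [∀ i, Module T (F i)] [∀ i, Module.Flat T (F i)]
    (d : ∀ i, F (i + 1) →ₗ[T] F i) (ε : F 0 →ₗ[T] (T ⧸ I)) (hε : Surjective ε)
    (h0 : Exact (d 0) ε) (hd : ∀ i, Exact (d (i + 1)) (d i)) (i : ℕ) :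
    Exact ((d (i + 1)).baseChange R) ((d i).baseChange R) := by
  -- These cokernels are T/I and its successive syzygies.
  have hcoker : ∀ i, IsWeaklyRegular (S ⊗[T] (F i ⧸ LinearMap.range (d i))) rs := by
    intro i
    induction i with
    | zero =>
      let e₁ : (F 0 ⧸ LinearMap.range (d 0)) ≃ₗ[T] (T ⧸ I) :=
        (Submodule.quotEquivOfEq _ _ h0.linearMap_ker_eq.symm).trans
          (ε.quotKerEquivOfSurjective hε)
      refine ((e₁.baseChange T S _ _).isWeaklyRegular_congr _).2 ?_
      exact ((Ideal.qoutMapEquivTensorQout S).isWeaklyRegular_congr _).1 hI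
    | succ i ih => exact isWeaklyRegular_tensor_coker_of_exact (hd i) hS ih
  exact exact_baseChange_of_isWeaklyRegular_coker (hd i) ev hev hrs (hcoker i)

end BaseChange

/-! ### Degrees under evaluation at forms -/

section Degrees

variable {K σ τ : Type*} [Field K]

theorem PolyHasDegree.add {p p' : MvPolynomial σ K} {q : ℤ} (h : PolyHasDegree p q)
    (h' : PolyHasDegree p' q) : PolyHasDegree (p + p') q := by
  rcases h with rfl | ⟨e, he, hp⟩
  · rwa [zero_add]
  · rcases h' with rfl | ⟨e', he', hp'⟩
    · rw [add_zero]
      exact Or.inr ⟨e, he, hp⟩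
    · obtain rfl : e = e' := by exact_mod_cast he.trans he'.symm
      exact Or.inr ⟨e, he, hp.add hp'⟩

theorem PolyHasDegree.sum {ι : Type*} {A : Finset ι} {p : ι → MvPolynomial σ K} {q : ℤ}
    (h : ∀ i ∈ A, PolyHasDegree (p i) q) : PolyHasDegree (∑ i ∈ A, p i) q :=
  Finset.sum_induction p (PolyHasDegree · q) (fun _ _ => PolyHasDegree.add) (Or.inl rfl) h

theorem PolyHasDegree.mul {p p' : MvPolynomial σ K} {q q' : ℤ} (h : PolyHasDegree p q)
    (h' : PolyHasDegree p' q') : PolyHasDegree (p * p') (q + q') := by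
  rcases h with rfl | ⟨e, he, hp⟩
  · exact Or.inl (zero_mul _)
  · rcases h' with rfl | ⟨e', he', hp'⟩
    · exact Or.inl (mul_zero _)
    · exact Or.inr ⟨e + e', by push_cast; rw [he, he'], hp.mul hp'⟩

theorem PolyHasDegree.aeval {p : MvPolynomial σ K} {q : ℤ} (h : PolyHasDegree p q) {d : ℕ}
    {f : σ → MvPolynomial τ K} (hf : ∀ i, (f i).IsHomogeneous d) :
    PolyHasDegree (aeval f p) (d * q) := by
  rcases h with rfl | ⟨e, he, hp⟩
  · exact Or.inl (map_zero _)
  · exact Or.inr ⟨d * e, by push_cast; rw [he], hp.aeval f hf⟩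

theorem MvPolynomial.IsHomogeneous.mem_idealOfVars {p : MvPolynomial τ K} {d : ℕ}
    (hp : p.IsHomogeneous d) (hd : 1 ≤ d) : p ∈ idealOfVars τ K := by
  rw [← pow_one (idealOfVars τ K), mem_pow_idealOfVars_iff]
  intro m hm
  have := hp (mem_support_iff.1 hm)
  rw [Finsupp.degree_eq_weight_one]
  exact hd.trans_eq this.symm

theorem map_aeval_idealOfVars_le {f : σ → MvPolynomial τ K} {d : ℕ}
    (hf : ∀ i, (f i).IsHomogeneous d) (hd : 1 ≤ d) {p : MvPolynomial σ K}
    (hp : p ∈ idealOfVars σ K) : aeval f p ∈ idealOfVars τ K := by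
  have hle : idealOfVars σ K ≤
      (idealOfVars τ K).comap (MvPolynomial.aeval f : MvPolynomial σ K →ₐ[K] _) := by
    refine Ideal.span_le.2 ?_
    rintro _ ⟨i, rfl⟩
    simpa using (hf i).mem_idealOfVars hd
  exact hle hp

end Degrees

/-! ### Exactness for the ideals of deficit sets -/

section Resolution

open RingTheory.Sequence Function

theorem map_exponentIdeal (K : Type*) {R σ : Type*} [CommRing K] [CommRing R] (g : K →+* R)
    (U : Set (σ →₀ ℕ)) : (exponentIdeal K U).map (MvPolynomial.map g) = exponentIdeal R U := by
  rw [exponentIdeal, Ideal.map_span, exponentIdeal, Set.image_image]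
  simp

theorem isWeaklyRegular_graphSequence {R : Type*} [CommRing R] {s k : ℕ} {f : Fin s → R}
    (hf : IsRegularModOthers f k) :
    IsWeaklyRegular (MvPolynomial (Fin s) R) (graphSequence f) := by
  -- With `A = ∅` the quotient is the whole ring; `w = 1` is a dummy, dropped afterwards.
  have h := isWeaklyRegular_graphSequence_span_X hf (w := 1) (fun A _ x hx => by simpa using hx) ∅
    (by simp)
  have h1 := ((isWeaklyRegular_append_iff _ _ _).1 h).1
  have e : (MvPolynomial (Fin s) R ⧸ Ideal.span (X '' ((∅ : Finset (Fin s)) : Set (Fin s)) :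
      Set (MvPolynomial (Fin s) R))) ≃ₗ[MvPolynomial (Fin s) R] MvPolynomial (Fin s) R :=
    Submodule.quotEquivOfEqBot _ (by simp)
  exact (e.isWeaklyRegular_congr _).1 h1

theorem isWeaklyRegular_graphSequence_quotient {R : Type*} [CommRing R] {s k : ℕ} {f : Fin s → R}
    (hf : IsRegularModOthers f k) (hk : k ≤ s) (B c : ℕ) :
    IsWeaklyRegular (MvPolynomial (Fin s) R ⧸ exponentIdeal R (deficitSet s B k c))
      (graphSequence f) :=
  ((isWeaklyRegular_append_iff _ _ _).1 (isWeaklyRegular_graphSequence_deficitSet hk hf (w := 1)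
    (fun A _ x hx => by simpa using hx) B c)).1

theorem flat_mvPolynomial (K R σ : Type*) [Field K] [CommRing R] [Algebra K R] :
    letI : Algebra (MvPolynomial σ K) (MvPolynomial σ R) := algebraMvPolynomial
    Module.Flat (MvPolynomial σ K) (MvPolynomial σ R) := by
  let _ : Algebra (MvPolynomial σ K) (MvPolynomial σ R) := algebraMvPolynomial
  have h : Algebra.IsPushout K (MvPolynomial σ K) R (MvPolynomial σ R) := inferInstance
  exact Module.Flat.isBaseChange K (MvPolynomial σ K) R (MvPolynomial σ R) h.out

/-- Base change along `X_i ↦ f_i` preserves exactness of free resolutions of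
`T / I_a(z_1^b ⋯ z_s^b)^(m)`. -/
theorem exact_baseChange_of_resolution_deficitSet {K R : Type*} [Field K] [CommRing R]
    [Algebra K R] {s k : ℕ} {f : Fin s → R} (hf : IsRegularModOthers f k) (hk : k ≤ s) {B c : ℕ}
    [Algebra (MvPolynomial (Fin s) K) R]
    (halg : ∀ t, algebraMap (MvPolynomial (Fin s) K) R t = aeval f t)
    {F : ℕ → Type*} [∀ i, AddCommGroup (F i)] [∀ i, Module (MvPolynomial (Fin s) K) (F i)]
    [∀ i, Module.Flat (MvPolynomial (Fin s) K) (F i)]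
    (d : ∀ i, F (i + 1) →ₗ[MvPolynomial (Fin s) K] F i)
    (ε : F 0 →ₗ[MvPolynomial (Fin s) K]
      (MvPolynomial (Fin s) K ⧸ exponentIdeal K (deficitSet s B k c)))
    (hε : Surjective ε) (h0 : Exact (d 0) ε) (hd : ∀ i, Exact (d (i + 1)) (d i)) (i : ℕ) :
    Exact ((d (i + 1)).baseChange R) ((d i).baseChange R) := by
  -- Factor T → R as the flat extension T → R[X] followed by X_i ↦ f_i, whose kernel the graph
  -- sequence generates.
  let algS : Algebra (MvPolynomial (Fin s) K) (MvPolynomial (Fin s) R) := algebraMvPolynomial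
  have hflat := flat_mvPolynomial K R (Fin s)
  let ev : MvPolynomial (Fin s) R →ₐ[MvPolynomial (Fin s) K] R :=
    { (aeval f : MvPolynomial (Fin s) R →ₐ[R] R).toRingHom with
      commutes' := fun t => by
        rw [halg]
        exact aeval_map_algebraMap R f t }
  have hev : Surjective ev := fun r => ⟨C r, aeval_C f r⟩
  have hker : ∀ x, ev x = 0 ↔ x ∈ Ideal.ofList (graphSequence f) := fun x =>
    (mem_ofList_graphSequence_iff f x).symm
  have hI : IsWeaklyRegular (MvPolynomial (Fin s) R ⧸
      (exponentIdeal K (deficitSet s B k c)).map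
        (algebraMap (MvPolynomial (Fin s) K) (MvPolynomial (Fin s) R))) (graphSequence f) := by
    have h1 : (exponentIdeal K (deficitSet s B k c)).map
        (algebraMap (MvPolynomial (Fin s) K) (MvPolynomial (Fin s) R)) =
        exponentIdeal R (deficitSet s B k c) := map_exponentIdeal K (algebraMap K R) _
    rw [h1]
    exact isWeaklyRegular_graphSequence_quotient hf hk B c
  exact exact_baseChange_of_resolution ev hev hker (isWeaklyRegular_graphSequence hf) hI d ε hε h0
    hd i

end Resolution

/-! ### Grading and minimality after base change -/

section GradedBaseChange

variable {K : Type u} [Field K] {σ τ : Type w}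

namespace GradedFreeSequence

theorem hasDegree_basis (C : GradedFreeSequence.{u, v, w} K σ) (i : ℕ) (l : Fin (C.rank i)) :
    C.HasDegree i (C.basis i l) (C.deg i l) := by
  intro k
  rw [Module.Basis.repr_self, Finsupp.single_apply]
  split_ifs with h
  · subst h
    exact Or.inr ⟨0, by simp, isHomogeneous_one _ _⟩
  · exact Or.inl rfl

variable (C : GradedFreeSequence.{u, v, w} K σ) {f : σ → MvPolynomial τ K} {e : ℕ}

theorem baseChange_basis (i : ℕ) (l : Fin (C.rank i)) :
    (C.baseChange (aeval f) e).basis i l = C.toBaseChange (aeval f) e i (C.basis i l) := by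
  let _ : Algebra (MvPolynomial σ K) (MvPolynomial τ K) :=
    (aeval f : MvPolynomial σ K →ₐ[K] MvPolynomial τ K).toRingHom.toAlgebra
  exact Module.Basis.baseChange_apply _ _ _

theorem baseChange_repr_toBaseChange (i : ℕ) (x : C.F i) (l : Fin (C.rank i)) :
    ((C.baseChange (aeval f) e).basis i).repr (C.toBaseChange (aeval f) e i x) l =
      aeval f ((C.basis i).repr x l) := by
  let _ : Algebra (MvPolynomial σ K) (MvPolynomial τ K) :=
    (aeval f : MvPolynomial σ K →ₐ[K] MvPolynomial τ K).toRingHom.toAlgebra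
  refine Eq.trans (Module.Basis.baseChange_repr_tmul _ _ _ _ _) ?_
  rw [Algebra.smul_def, mul_one]
  rfl

theorem baseChange_d_toBaseChange (i : ℕ) (x : C.F (i + 1)) :
    (C.baseChange (aeval f) e).d i (C.toBaseChange (aeval f) e (i + 1) x) =
      C.toBaseChange (aeval f) e i (C.d i x) := by
  let _ : Algebra (MvPolynomial σ K) (MvPolynomial τ K) :=
    (aeval f : MvPolynomial σ K →ₐ[K] MvPolynomial τ K).toRingHom.toAlgebra
  exact LinearMap.baseChange_tmul _ _ _

theorem toBaseChange_smul (i : ℕ) (t : MvPolynomial σ K) (x : C.F i) :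
    C.toBaseChange (aeval f) e i (t • x) = aeval f t • C.toBaseChange (aeval f) e i x := by
  let _ : Algebra (MvPolynomial σ K) (MvPolynomial τ K) :=
    (aeval f : MvPolynomial σ K →ₐ[K] MvPolynomial τ K).toRingHom.toAlgebra
  refine (TensorProduct.tmul_smul t (1 : MvPolynomial τ K) x).trans ?_
  exact (algebraMap_smul (MvPolynomial τ K) t _).symm

theorem toBaseChange_add (i : ℕ) (x y : C.F i) :
    C.toBaseChange (aeval f) e i (x + y) =
      C.toBaseChange (aeval f) e i x + C.toBaseChange (aeval f) e i y :=
  let _ : Algebra (MvPolynomial σ K) (MvPolynomial τ K) :=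
    (aeval f : MvPolynomial σ K →ₐ[K] MvPolynomial τ K).toRingHom.toAlgebra
  TensorProduct.tmul_add _ _ _

theorem baseChange_sum_repr (i : ℕ) (x : (C.baseChange (aeval f) e).F i) :
    x = ∑ l, ((C.baseChange (aeval f) e).basis i).repr x l •
      C.toBaseChange (aeval f) e i (C.basis i l) := by
  conv_lhs => rw [← ((C.baseChange (aeval f) e).basis i).sum_repr x]
  exact Finset.sum_congr rfl fun l _ => congrArg _ (C.baseChange_basis i l)

variable {C}

theorem baseChange_d_hasDegree
    (hd : ∀ (i : ℕ) (x : C.F (i + 1)) (q : ℤ), C.HasDegree (i + 1) x q → C.HasDegree i (C.d i x) q)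
    (hf : ∀ i, (f i).IsHomogeneous e) (i : ℕ) (x : (C.baseChange (aeval f) e).F (i + 1)) (q : ℤ)
    (hx : (C.baseChange (aeval f) e).HasDegree (i + 1) x q) :
    (C.baseChange (aeval f) e).HasDegree i ((C.baseChange (aeval f) e).d i x) q := by
  intro j
  rw [C.baseChange_sum_repr (i + 1) x, map_sum, map_sum, Finsupp.finsetSum_apply]
  refine PolyHasDegree.sum fun l _ => ?_
  rw [map_smul, map_smul, Finsupp.smul_apply, smul_eq_mul, baseChange_d_toBaseChange,
    C.baseChange_repr_toBaseChange i _ j]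
  have h1 := (hx l).mul (((hd i _ _ (C.hasDegree_basis (i + 1) l)) j).aeval hf)
  have h2 : q - (e : ℤ) * C.deg (i + 1) l + e * (C.deg (i + 1) l - C.deg i j) =
      q - e * C.deg i j := by ring
  exact h2 ▸ h1

theorem baseChange_range_d_le
    (hmin : ∀ i, LinearMap.range (C.d i) ≤
      idealOfVars σ K • (⊤ : Submodule (MvPolynomial σ K) (C.F i)))
    (hf : ∀ i, (f i).IsHomogeneous e) (he : 1 ≤ e) (i : ℕ) :
    LinearMap.range ((C.baseChange (aeval f) e).d i) ≤ idealOfVars τ K •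
      (⊤ : Submodule (MvPolynomial τ K) ((C.baseChange (aeval f) e).F i)) := by
  have key : ∀ y ∈ idealOfVars σ K • (⊤ : Submodule (MvPolynomial σ K) (C.F i)),
      C.toBaseChange (aeval f) e i y ∈ idealOfVars τ K •
        (⊤ : Submodule (MvPolynomial τ K) ((C.baseChange (aeval f) e).F i)) := by
    intro y hy
    refine Submodule.smul_induction_on hy (fun t ht n _ => ?_) fun a b ha hb => ?_
    · rw [toBaseChange_smul]
      exact Submodule.smul_mem_smul (map_aeval_idealOfVars_le hf he ht) trivial
    · rw [toBaseChange_add]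
      exact Submodule.add_mem _ ha hb
  rintro _ ⟨x, rfl⟩
  rw [C.baseChange_sum_repr (i + 1) x, map_sum]
  refine Submodule.sum_mem _ fun l _ => ?_
  rw [map_smul, baseChange_d_toBaseChange]
  exact Submodule.smul_mem _ _ (key _ (hmin i ⟨_, rfl⟩))

theorem baseChange_aug_hasDegree {I : Ideal (MvPolynomial σ K)} {J : Ideal (MvPolynomial τ K)}
    {ε : C.F 0 →ₗ[MvPolynomial σ K] (MvPolynomial σ K ⧸ I)}
    (hε : ∀ (x : C.F 0) (q : ℤ), C.HasDegree 0 x q →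
      ∃ p : MvPolynomial σ K, PolyHasDegree p q ∧ Ideal.Quotient.mk I p = ε x)
    {ε' : (C.baseChange (aeval f) e).F 0 →ₗ[MvPolynomial τ K] (MvPolynomial τ K ⧸ J)}
    (hε' : ∀ (x : C.F 0) (t : MvPolynomial σ K), ε x = Ideal.Quotient.mk I t →
      ε' (C.toBaseChange (aeval f) e 0 x) = Ideal.Quotient.mk J (aeval f t))
    (hf : ∀ i, (f i).IsHomogeneous e) (x : (C.baseChange (aeval f) e).F 0) (q : ℤ)
    (hx : (C.baseChange (aeval f) e).HasDegree 0 x q) :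
    ∃ p : MvPolynomial τ K, PolyHasDegree p q ∧ Ideal.Quotient.mk J p = ε' x := by
  choose p hp hpε using fun l => hε _ _ (C.hasDegree_basis 0 l)
  refine ⟨∑ l, ((C.baseChange (aeval f) e).basis 0).repr x l * aeval f (p l),
    PolyHasDegree.sum fun l _ => ?_, ?_⟩
  · have h1 := (hx l).mul ((hp l).aeval hf)
    have h2 : q - (e : ℤ) * C.deg 0 l + e * C.deg 0 l = q := by ring
    exact h2 ▸ h1
  · conv_rhs => rw [C.baseChange_sum_repr 0 x]
    rw [map_sum, map_sum]
    refine Finset.sum_congr rfl fun l _ => ?_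
    rw [map_smul, hε' _ _ (hpε l).symm, map_mul]
    rfl

end GradedFreeSequence

end GradedBaseChange

/-! ### The base-changed minimal resolution -/

section ResolutionBaseChange

variable {K : Type u} [Field K] {τ : Type} {s k e : ℕ} {f : Fin s → MvPolynomial τ K}

theorem qoutMapEquivTensorQout_mk {T R : Type*} [CommRing T] [CommRing R] [Algebra T R]
    (I : Ideal T) (r : R) :
    I.qoutMapEquivTensorQout R (Ideal.Quotient.mk _ r) = r ⊗ₜ[T] (1 : T ⧸ I) :=
  rfl

theorem GradedFreeSequence.IsMinimalResolution.exists_baseChange (hf : IsRegularModOthers f k)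
    (hk : k ≤ s) {B c : ℕ} (hfe : ∀ i, (f i).IsHomogeneous e) (he : 1 ≤ e)
    {C : GradedFreeSequence.{u, v, 0} K (Fin s)}
    {ε : C.F 0 →ₗ[MvPolynomial (Fin s) K]
      (MvPolynomial (Fin s) K ⧸ exponentIdeal K (deficitSet s B k c))}
    (hC : C.IsMinimalResolution (exponentIdeal K (deficitSet s B k c)) ε) :
    ∃ ε' : (C.baseChange (aeval f) e).F 0 →ₗ[MvPolynomial τ K] (MvPolynomial τ K ⧸
        (exponentIdeal K (deficitSet s B k c)).map (aeval f : MvPolynomial (Fin s) K →ₐ[K] _)),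
      (∀ (x : C.F 0) (t : MvPolynomial (Fin s) K), ε x = Ideal.Quotient.mk _ t →
        ε' (C.toBaseChange (aeval f) e 0 x) = Ideal.Quotient.mk _ (aeval f t)) ∧
      (C.baseChange (aeval f) e).IsMinimalResolution _ ε' := by
  let algR : Algebra (MvPolynomial (Fin s) K) (MvPolynomial τ K) :=
    (aeval f : MvPolynomial (Fin s) K →ₐ[K] MvPolynomial τ K).toRingHom.toAlgebra
  have hflat : ∀ i, Module.Flat (MvPolynomial (Fin s) K) (C.F i) := fun i =>
    have := Module.Free.of_basis (C.basis i)
    inferInstance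
  let eq := (exponentIdeal K (deficitSet s B k c)).qoutMapEquivTensorQout (MvPolynomial τ K)
  let ε' : (MvPolynomial τ K ⊗[MvPolynomial (Fin s) K] C.F 0) →ₗ[MvPolynomial τ K]
      (MvPolynomial τ K ⧸ (exponentIdeal K (deficitSet s B k c)).map
        (algebraMap (MvPolynomial (Fin s) K) (MvPolynomial τ K))) :=
    eq.symm.toLinearMap ∘ₗ ε.baseChange (MvPolynomial τ K)
  have haug : ∀ (x : C.F 0) (t : MvPolynomial (Fin s) K), ε x = Ideal.Quotient.mk _ t →
      ε' (1 ⊗ₜ x) = Ideal.Quotient.mk _ (aeval f t) := by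
    intro x t hx
    have h1 : ε' (1 ⊗ₜ x) = eq.symm (1 ⊗ₜ ε x) := rfl
    rw [h1, LinearEquiv.symm_apply_eq, hx]
    refine Eq.trans ?_ (qoutMapEquivTensorQout_mk _ _).symm
    have h2 : Ideal.Quotient.mk (exponentIdeal K (deficitSet s B k c)) t =
        t • Ideal.Quotient.mk (exponentIdeal K (deficitSet s B k c)) 1 := by
      conv_lhs => rw [← mul_one t]
      rfl
    have h3 : (t • (1 : MvPolynomial τ K)) = aeval f t := by
      rw [Algebra.smul_def, mul_one]
      rfl
    rw [h2, TensorProduct.tmul_smul, TensorProduct.smul_tmul', h3]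
    rfl
  have hsurj : Function.Surjective ε' :=
    eq.symm.surjective.comp (LinearMap.lTensor_surjective (MvPolynomial τ K) hC.aug_surjective)
  have hex : Function.Exact ((C.d 0).baseChange (MvPolynomial τ K)) ε' := by
    intro x
    have h1 := lTensor_exact (MvPolynomial τ K) hC.exact_zero hC.aug_surjective x
    refine Iff.trans ?_ h1
    exact eq.symm.map_eq_zero_iff
  refine ⟨ε', haug, ?_⟩
  exact
    { d_homogeneous := GradedFreeSequence.baseChange_d_hasDegree hC.d_homogeneous hfe
      aug_homogeneous := GradedFreeSequence.baseChange_aug_hasDegree hC.aug_homogeneous haug hfe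
      aug_surjective := hsurj
      exact_zero := hex
      exact_succ := exact_baseChange_of_resolution_deficitSet hf hk (fun _ => rfl) C.d ε
        hC.aug_surjective hC.exact_zero hC.exact_succ
      minimal := GradedFreeSequence.baseChange_range_d_le hC.minimal hfe he }

end ResolutionBaseChange

/-! ### Minimal generators -/

section MinimalGenerators

/-- The elements of `U` which are minimal with respect to divisibility. -/
def minimalExponents {σ : Type*} (U : Set (σ →₀ ℕ)) : Set (σ →₀ ℕ) :=
  {α | α ∈ U ∧ ∀ β ∈ U, β ≤ α → β = α}

variable {K : Type*} [Field K] {s k : ℕ}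

theorem monomial_mem_exponentIdeal_iff {σ : Type*} {U : Set (σ →₀ ℕ)} (hU : IsUpperSet U)
    (α : σ →₀ ℕ) : monomial α (1 : K) ∈ exponentIdeal K U ↔ α ∈ U := by
  classical
  rw [mem_exponentIdeal_iff hU]
  simp [coeff_monomial]

theorem minimalMonomialGenerators_exponentIdeal {σ : Type*} {U : Set (σ →₀ ℕ)}
    (hU : IsUpperSet U) : minimalMonomialGenerators (exponentIdeal K U) =
      (fun α => monomial α (1 : K)) '' minimalExponents U := by
  ext g
  simp only [minimalMonomialGenerators, minimalExponents, Set.mem_ofPred_eq, Set.mem_image,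
    monomial_mem_exponentIdeal_iff hU]
  constructor
  · rintro ⟨α, rfl, h, h'⟩
    exact ⟨α, ⟨(monomial_mem_exponentIdeal_iff hU α).1 h, h'⟩, rfl⟩
  · rintro ⟨α, ⟨h, h'⟩, rfl⟩
    exact ⟨α, rfl, (monomial_mem_exponentIdeal_iff hU α).2 h, h'⟩

theorem exists_minimalExponents_le {U : Set (Fin s →₀ ℕ)} {α : Fin s →₀ ℕ} (hα : α ∈ U) :
    ∃ β ∈ minimalExponents U, β ≤ α := by
  obtain ⟨β, hβ, hmin⟩ := exists_minimal_le_of_wellFoundedLT (· ∈ U) α hα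
  exact ⟨β, ⟨hmin.1, fun γ hγ hle => le_antisymm hle (hmin.2 hγ hle)⟩, hβ⟩

theorem powerProductIdeal_minimalExponents {R : Type*} [CommRing R] (f : Fin s → R)
    (U : Set (Fin s →₀ ℕ)) : powerProductIdeal f (minimalExponents U) = powerProductIdeal f U := by
  apply le_antisymm
  · exact powerProductIdeal_mono fun _ h => h.1
  · refine Ideal.span_le.2 ?_
    rintro _ ⟨α, hα, rfl⟩
    obtain ⟨β, hβ, hle⟩ := exists_minimalExponents_le hα
    exact Ideal.mem_of_dvd _ (Finset.prod_dvd_prod_of_dvd _ _ fun i _ => pow_dvd_pow (f i) (hle i))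
      (Ideal.subset_span ⟨β, hβ, rfl⟩)

variable {R : Type*} [CommRing R] {f : Fin s → R}

/-- A relation between the products `∏ f_i ^ α_i`, with `α` in the minimal exponents, has
coefficients in the ideal of the `f_i`. -/
theorem coeff_mem_span_range_of_aeval_eq_zero (hf : IsRegularModOthers f k) (hk : k ≤ s) {B c : ℕ}
    {p : MvPolynomial (Fin s) R}
    (hp : ∀ α, coeff α p ≠ 0 → α ∈ deficitSet s B k c)
    (h0 : aeval f p = 0) {α : Fin s →₀ ℕ} (hα : α ∈ minimalExponents (deficitSet s B k c)) :
    coeff α p ∈ Ideal.span (Set.range f) := by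
  have hU : IsUpperSet (deficitSet s B k c) := isUpperSet_deficitSet B k c
  -- The intersection of the two ideals is their product, by regularity of the graph sequence.
  have h1 : p ∈ Ideal.ofList (graphSequence f) * exponentIdeal R (deficitSet s B k c) :=
    ofList_inf_le_mul_of_isWeaklyRegular (isWeaklyRegular_graphSequence_quotient hf hk B c)
      ⟨(mem_ofList_graphSequence_iff f p).2 h0, (mem_exponentIdeal_iff hU).2 hp⟩
  have hconst : ∀ a ∈ Ideal.ofList (graphSequence f), coeff 0 a ∈ Ideal.span (Set.range f) := by
    have hle : Ideal.ofList (graphSequence f) ≤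
        (Ideal.span (Set.range f)).comap (constantCoeff : MvPolynomial (Fin s) R →+* R) := by
      refine Ideal.span_le.2 fun x hx => ?_
      simp only [graphSequence, List.mem_map, Set.mem_ofPred_eq] at hx
      obtain ⟨i, -, rfl⟩ := hx
      simpa using Ideal.subset_span (Set.mem_range_self i)
    exact fun a ha => hle ha
  refine Submodule.mul_induction_on h1 (fun a ha b hb => ?_) fun x y hx hy => ?_
  · rw [coeff_mul]
    refine Ideal.sum_mem _ fun x hx => ?_
    have hx' := Finset.HasAntidiagonal.mem_antidiagonal.1 hx
    by_cases hxb : coeff x.2 b = 0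
    · rw [hxb, mul_zero]
      exact Ideal.zero_mem _
    -- Minimality of `α` forces `x.2 = α`, so the other factor is the constant term of an element of
    -- the graph ideal.
    · have h2 := hα.2 _ ((mem_exponentIdeal_iff hU).1 hb _ hxb) (hx' ▸ le_add_self)
      have h3 : x.1 = 0 := by
        rw [← h2] at hx'
        exact add_eq_right.1 hx'
      rw [h3]
      exact Ideal.mul_mem_right _ _ (hconst a ha)
  · rw [coeff_add]
    exact Ideal.add_mem _ hx hy

/-- Otherwise a polynomial with coefficient 1 at `α` would evaluate to 0, putting 1 in (f_1, …,
f_s). -/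
theorem prod_pow_notMem_span_of_minimalExponents (hf : IsRegularModOthers f k) (hk : k ≤ s)
    (hne : (1 : R) ∉ Ideal.span (Set.range f)) {B c : ℕ} {α : Fin s →₀ ℕ}
    (hα : α ∈ minimalExponents (deficitSet s B k c)) :
    ∏ i, f i ^ α i ∉ powerProductIdeal f (minimalExponents (deficitSet s B k c) \ {α}) := by
  classical
  intro h
  have key : ∀ x ∈ powerProductIdeal f (minimalExponents (deficitSet s B k c) \ {α}),
      ∃ q : MvPolynomial (Fin s) R, aeval f q = x ∧
        ∀ β, coeff β q ≠ 0 → β ∈ minimalExponents (deficitSet s B k c) \ {α} := by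
    intro x hx
    refine Submodule.span_induction ?_ ⟨0, by simp, by simp⟩ ?_ ?_ hx
    · rintro _ ⟨β, hβ, rfl⟩
      refine ⟨monomial β 1, aeval_monomial_one f β, fun γ hγ => ?_⟩
      rw [coeff_monomial] at hγ
      split_ifs at hγ with h
      · exact h ▸ hβ
      · exact absurd rfl hγ
    · rintro x y _ _ ⟨q, rfl, hq⟩ ⟨q', rfl, hq'⟩
      refine ⟨q + q', map_add _ _ _, fun β hβ => ?_⟩
      by_contra hn
      refine hβ ?_
      rw [coeff_add, not_not.1 fun h => hn (hq β h), not_not.1 fun h => hn (hq' β h), add_zero]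
    · rintro r x _ ⟨q, rfl, hq⟩
      refine ⟨C r * q, by simp, fun β hβ => hq β fun h => hβ ?_⟩
      rw [coeff_C_mul, h, mul_zero]
  obtain ⟨q, hq, hsupp⟩ := key _ h
  have h1 : coeff α q = 0 := not_not.1 fun h => (hsupp α h).2 rfl
  have h2 := coeff_mem_span_range_of_aeval_eq_zero hf hk (B := B) (c := c)
    (p := monomial α 1 - q) (fun β hβ => by
      by_cases hβα : α = β
      · exact hβα ▸ hα.1
      · rw [coeff_sub, coeff_monomial, if_neg hβα, zero_sub, neg_ne_zero] at hβ
        exact (hsupp β hβ).1.1) (by rw [map_sub, aeval_monomial_one, hq, sub_self]) hα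
  rw [coeff_sub, coeff_monomial, if_pos rfl, h1, sub_zero] at h2
  exact hne h2

theorem injOn_prod_pow_minimalExponents (hf : IsRegularModOthers f k) (hk : k ≤ s)
    (hne : (1 : R) ∉ Ideal.span (Set.range f)) (B c : ℕ) :
    Set.InjOn (fun α : Fin s →₀ ℕ => ∏ i, f i ^ α i)
      (minimalExponents (deficitSet s B k c)) := by
  intro α hα β hβ h
  by_contra hne'
  refine prod_pow_notMem_span_of_minimalExponents hf hk hne hα ?_
  rw [show ∏ i, f i ^ α i = ∏ i, f i ^ β i from h]
  exact Ideal.subset_span ⟨β, ⟨hβ, Ne.symm hne'⟩, rfl⟩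

theorem isMinimalGeneratingSet_prod_pow (hf : IsRegularModOthers f k) (hk : k ≤ s)
    (hne : (1 : R) ∉ Ideal.span (Set.range f)) (B c : ℕ) :
    IsMinimalGeneratingSet
      ((fun α : Fin s →₀ ℕ => ∏ i, f i ^ α i) '' minimalExponents (deficitSet s B k c))
      (powerProductIdeal f (deficitSet s B k c)) := by
  refine ⟨powerProductIdeal_minimalExponents f _, fun S' hS' hspan => ?_⟩
  obtain ⟨_, ⟨α, hα, rfl⟩, hαS⟩ := Set.exists_of_ssubset hS'
  refine prod_pow_notMem_span_of_minimalExponents hf hk hne hα ?_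
  have h1 : ∏ i, f i ^ α i ∈ Ideal.span S' := by
    rw [hspan]
    exact Ideal.subset_span ⟨α, hα.1, rfl⟩
  refine Ideal.span_mono (fun x hx => ?_) h1
  obtain ⟨β, hβ, rfl⟩ := hS'.1 hx
  refine ⟨β, ⟨hβ, ?_⟩, rfl⟩
  rintro rfl
  exact hαS hx

end MinimalGenerators

/-! ### The theorem -/

section Main

theorem isRegularModOthers_X (K : Type*) [Field K] (s k : ℕ) :
    IsRegularModOthers (fun i => (X i : MvPolynomial (Fin s) K)) k := by
  intro A j hj _ p hp
  rw [mem_ideal_span_X_image] at hp ⊢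
  intro m hm
  obtain ⟨i, hi, hne⟩ := hp (Finsupp.single j 1 + m) (by
    rw [mem_support_iff, coeff_X_mul]
    exact mem_support_iff.1 hm)
  refine ⟨i, hi, ?_⟩
  have hij : j ≠ i := fun h => hj (h ▸ hi)
  rwa [Finsupp.add_apply, Finsupp.single_eq_of_ne' hij, zero_add] at hne

/-- A constant is either zero, hence a zero divisor, or a unit generating the whole ring. -/
theorem IsCGeneric.one_le_degree {K τ : Type*} [Field K] {s c d : ℕ}
    {f : Fin s → MvPolynomial τ K} (h : IsCGeneric f c) (hs : 0 < s)
    (hf : ∀ i, (f i).IsHomogeneous d) : 1 ≤ d := by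
  by_contra hd
  obtain rfl : d = 0 := by omega
  have h1 := h [⟨0, hs⟩] (List.nodup_singleton _) (by simp)
  obtain ⟨r, hr⟩ : ∃ r, f ⟨0, hs⟩ = C r :=
    ⟨_, totalDegree_eq_zero_iff_eq_C.1 ((totalDegree_zero_iff_isHomogeneous _).2 (hf ⟨0, hs⟩))⟩
  rw [List.map_singleton, hr] at h1
  rcases eq_or_ne r 0 with rfl | hr0
  · have h2 := (RingTheory.Sequence.isWeaklyRegular_singleton_iff _ _).1 h1.toIsWeaklyRegular
    rw [map_zero] at h2
    exact one_ne_zero (h2 (show (0 : MvPolynomial τ K) • (1 : MvPolynomial τ K) = 0 • 0 by simp))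
  · refine h1.top_ne_smul ?_
    rw [Ideal.ofList_singleton, Ideal.span_singleton_eq_top.2 ((isUnit_iff_ne_zero.2 hr0).map C)]
    simp

theorem mainTheorem5 {K : Type u} [Field K] [Infinite K]
    (n s a b d δ m : ℕ) (hn : 1 ≤ n) (ha : 1 ≤ a) (hb : 1 ≤ b) (hm : 1 ≤ m)
    (hs : n + 1 ≤ s) (ha_lower : b * (s - n) + 1 ≤ a) (ha_upper : a ≤ s * b)
    (ha_large : (b - 1) * s + 1 < a) (hδ : δ = a - (b - 1) * s - 1) (hδn : s - n ≤ δ)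
    (f : Fin s → MvPolynomial (Fin (n + 1)) K) (hf : ∀ i, (f i).IsHomogeneous d)
    (hgen : IsCGeneric f (s - δ))
    (φ : MvPolynomial (Fin s) K →ₐ[K] MvPolynomial (Fin (n + 1)) K)
    (hφ : φ = MvPolynomial.aeval f)
    (IT : Ideal (MvPolynomial (Fin s) K))
    (hIT : IT = symbolicPower
      (foldProductIdeal (fun i => (MvPolynomial.X i : MvPolynomial (Fin s) K)) (fun _ => b) a) m)
    (IR : Ideal (MvPolynomial (Fin (n + 1)) K))
    (hIR : IR = symbolicPower (foldProductIdeal f (fun _ => b) a) m) :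
    IR = IT.map φ ∧
    (∀ (C : GradedFreeSequence.{u, v, 0} K (Fin s))
      (ε : C.F 0 →ₗ[MvPolynomial (Fin s) K] (MvPolynomial (Fin s) K ⧸ IT)),
      C.IsMinimalResolution IT ε →
      ∃ ε' : (C.baseChange φ d).F 0 →ₗ[MvPolynomial (Fin (n + 1)) K]
          (MvPolynomial (Fin (n + 1)) K ⧸ IR),
        (∀ (x : C.F 0) (t : MvPolynomial (Fin s) K), ε x = Ideal.Quotient.mk IT t →
          ε' (C.toBaseChange φ d 0 x) = Ideal.Quotient.mk IR (φ t)) ∧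
        (C.baseChange φ d).IsMinimalResolution IR ε') ∧
    IsMinimalGeneratingSet (φ '' minimalMonomialGenerators IT) IR ∧
    Set.InjOn φ (minimalMonomialGenerators IT) := by
  subst hφ
  -- From δ = a - (b-1)s - 1 one gets s - δ = (sb - a) + 1; writing b = b' + 1 makes the arithmetic
  -- linear.
  have hk1 : 1 ≤ s - δ ∧ s - δ ≤ s ∧ s * b - a = s - δ - 1 := by
    obtain ⟨b', rfl⟩ : ∃ b', b = b' + 1 := ⟨b - 1, by omega⟩
    rw [Nat.add_sub_cancel, mul_comm b' s] at hδ ha_large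
    rw [mul_add, mul_one] at ha_upper ⊢
    omega
  obtain ⟨hk1, hk, hkc⟩ := hk1
  generalize s - δ = k at hk1 hk hkc hgen
  have hreg := hgen.isRegularModOthers
  have hd := hgen.one_le_degree (by omega) hf
  have hU : IsUpperSet (deficitSet s (m * b) k (m * (k - 1))) := isUpperSet_deficitSet _ _ _
  rw [foldProductIdeal_eq_powerProductIdeal _ ha_upper, hkc] at hIT hIR
  rw [symbolicPower_powerProductIdeal (isRegularModOthers_X K s k) le_rfl (fun i => isHomogeneous_X K i)
    hk hk1 hb, powerProductIdeal_X] at hIT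
  rw [symbolicPower_powerProductIdeal hreg hd hf hk hk1 hb] at hIR
  have hmap : IR = IT.map (aeval f : MvPolynomial (Fin s) K →ₐ[K] _) := by
    rw [hIT, hIR, map_aeval_exponentIdeal]
  have hne : (1 : MvPolynomial (Fin (n + 1)) K) ∉ Ideal.span (Set.range f) := by
    intro h
    have hle : Ideal.span (Set.range f) ≤ idealOfVars (Fin (n + 1)) K := by
      refine Ideal.span_le.2 ?_
      rintro _ ⟨i, rfl⟩
      exact (hf i).mem_idealOfVars hd
    have h1 := hle h
    rw [← pow_one (idealOfVars (Fin (n + 1)) K), ← C_1, C_mem_pow_idealOfVars_iff] at h1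
    simp at h1
  refine ⟨hmap, ?_, ?_, ?_⟩
  · subst hmap hIT
    exact fun C ε hC => hC.exists_baseChange hreg hk hf hd
  · rw [hIT, hIR, minimalMonomialGenerators_exponentIdeal hU, Set.image_image]
    simp only [aeval_monomial_one]
    exact isMinimalGeneratingSet_prod_pow hreg hk hne _ _
  · rw [hIT, minimalMonomialGenerators_exponentIdeal hU]
    rintro _ ⟨α, hα, rfl⟩ _ ⟨β, hβ, rfl⟩ h
    rw [aeval_monomial_one, aeval_monomial_one] at h
    rw [injOn_prod_pow_minimalExponents hreg hk hne _ _ hα hβ h]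

end Main
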